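/- Fix a positive integer $m$, real numbers $\tau>0$ and $\gamma>0$, and a matrix $\Delta_m\in\mathbb R^{m\times m}$ such that $-\Delta_m$ is symmetric positive definite. Put $\alpha=\tau^2/\sqrt{\gamma}$ and $L_m=I_m-\frac{\tau^2}{2}\Delta_m$. For a positive integer $n$ let $B_n^{(1)},B_n^{(2)}\in\mathbb R^{n\times n}$ be the lower triangular Toeplitz matrices whose entries on the main diagonal, the first and the second subdiagonal are $1,-2,1$ and $1,0,1$ respectively (all other entries being zero), let $\hat I_n=\mathrm{diag}(\tfrac12,1,\dots,1)$, $\check I_n=\mathrm{diag}(1,\dots,1,\tfrac12)$, and $$\mathcal T_n=B_n^{(1)}\otimes I_m-\tfrac{\tau^2}{2}B_n^{(2)}\otimes\Delta_m,\qquad \mathcal A_n=\begin{bmatrix}\alpha\check I_n\otimes I_m&\mathcal T_n^{T}\\ \mathcal T_n&-\alpha\hat I_n\otimes I_m\end{bmatrix}\in\mathbb R^{2mn\times 2mn}.$$ For $\theta\in\mathbb R$ let $h(\theta)=L_m-2I_me^{\mathbf i\theta}+L_me^{2\mathbf i\theta}$, $|h|=(h^*h)^{1/2}$ and $g=\sqrt{|h|^2+\alpha^2I_m}$.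 Then $\mathcal T_n=T_{(n,m)}[h]$ for every $n$, where $T_{(n,m)}[h]$ is the $n\times n$ block Toeplitz matrix whose $(r,s)$ block is the Fourier coefficient $\frac1{2\pi}\int_{-\pi}^{\pi}h(\theta)e^{-\mathbf i(r-s)\theta}\,d\theta$. Moreover, with $D=[0,2\pi]$, $p=-2\pi$, $\widetilde D=D\cup(p+D)=[-2\pi,2\pi]$, and $$\psi_g(\theta)=\begin{cases}g(\theta),&\theta\in D,\\ -g(\theta-p),&\theta\in p+D,\ \theta\notin D,\end{cases}$$ one has $\{\mathcal A_n\}_n\sim_\lambda\psi_g$ over $\widetilde D$; that is, $\psi_g$ is measurable and, for every continuous compactly supported $F:\mathbb C\to\mathbb C$, $$\lim_{n\to\infty}\frac1{2mn}\sum_{i=1}^{2mn}F(\lambda_i(\mathcal A_n))=\frac1{4\pi m}\int_{-2\pi}^{2\pi}\sum_{j=1}^{m}F(\lambda_j(\psi_g(\theta)))\,d\theta,$$ where $\lambda_i(\cdot)$ are the eigenvalues counted with multiplicity. -/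

import Mathlib

open MeasureTheory Filter Topology
open scoped Matrix Kronecker MatrixOrder CompactlySupported

noncomputable section

namespace WaveControl

/-! ### Asymptotic eigenvalue distributions of matrix-sequences -/

/-- The matrix-sequence `A`, where `A n` is a complex square matrix of order `Fintype.card (ι n)`,
has the asymptotic eigenvalue distribution described by the functional `η`: for every continuous
compactly supported `F : ℂ → ℂ`, the mean of `F` over the eigenvalues of `A n` (the roots of the
characteristic polynomial, with multiplicity) tends to `η F`. -/
def HasEigenvalueDistribution {ι : ℕ → Type*} [∀ n, Fintype (ι n)] [∀ n, DecidableEq (ι n)]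
    (A : ∀ n, Matrix (ι n) (ι n) ℂ) (η : C_c(ℂ, ℂ) → ℂ) : Prop :=
  ∀ F : C_c(ℂ, ℂ),
    Tendsto (fun n => (1 / (Fintype.card (ι n) : ℂ)) * ((A n).charpoly.roots.map F).sum)
      atTop (𝓝 (η F))

/-- The functional `η_f(F) = 1 / (q μ(D)) ∫_D ∑_{j=1}^q F(λ_j(f(θ))) dθ` of a matrix-valued
function `f` on `D`. Only the values of `f` on `D` matter. -/
def symbolFunctional {q : ℕ} (D : Set ℝ) (f : ℝ → Matrix (Fin q) (Fin q) ℂ)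
    (F : C_c(ℂ, ℂ)) : ℂ :=
  (1 / ((q : ℂ) * (volume.real D : ℂ))) * ∫ θ in D, ((f θ).charpoly.roots.map F).sum

/-- `{A_n}_n ∼_λ f`, where `f` is a measurable matrix-valued function on a measurable set `D`
of positive and finite Lebesgue measure. -/
def HasEigenvalueSymbol {ι : ℕ → Type*} [∀ n, Fintype (ι n)] [∀ n, DecidableEq (ι n)] {q : ℕ}
    (A : ∀ n, Matrix (ι n) (ι n) ℂ) (D : Set ℝ) (f : ℝ → Matrix (Fin q) (Fin q) ℂ) : Prop :=
  MeasurableSet D ∧ 0 < volume D ∧ volume D < ⊤ ∧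
    (∀ i j, Measurable fun x : D => f x i j) ∧
    HasEigenvalueDistribution A (symbolFunctional D f)

/-- The doubled domain `D ∪ (p + D)`. -/
def doubledDomain (D : Set ℝ) (p : ℝ) : Set ℝ :=
  D ∪ (fun x => p + x) '' D

open Classical in
/-- The function `ψ_g` on the doubled domain: `g(x)` for `x ∈ D`, and `-g(x - p)` for
`x ∈ p + D`, `x ∉ D` (the values outside the doubled domain are irrelevant). -/
def psi {q : ℕ} (D : Set ℝ) (p : ℝ) (g : ℝ → Matrix (Fin q) (Fin q) ℂ) :
    ℝ → Matrix (Fin q) (Fin q) ℂ :=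
  fun x => if x ∈ D then g x else -g (x - p)

/-! ### Block Toeplitz matrices -/

/-- The Fourier coefficient `(1 / 2π) ∫_{-π}^{π} f(θ) e^{-ikθ} dθ`, computed entrywise. -/
def matrixFourierCoeff {m : ℕ} (f : ℝ → Matrix (Fin m) (Fin m) ℂ) (k : ℤ) :
    Matrix (Fin m) (Fin m) ℂ :=
  Matrix.of fun i j => (1 / (2 * (Real.pi : ℂ))) *
    ∫ θ in (-Real.pi)..Real.pi, f θ i j * Complex.exp (-Complex.I * (k : ℂ) * (θ : ℂ))

/-- The block Toeplitz matrix `T_{(n,m)}[f]`, whose block in position `(r, s)` is the Fourier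
coefficient of `f` of index `r - s`. -/
def blockToeplitz {m : ℕ} (n : ℕ) (f : ℝ → Matrix (Fin m) (Fin m) ℂ) :
    Matrix (Fin n × Fin m) (Fin n × Fin m) ℂ :=
  Matrix.of fun x y => matrixFourierCoeff f ((x.1.val : ℤ) - (y.1.val : ℤ)) x.2 y.2

/-! ### The all-at-once matrix of the wave control problem -/

/-- The lower triangular Toeplitz matrix with `1, -2, 1` on the main diagonal and on the first two
subdiagonals. -/
def B₁ (n : ℕ) : Matrix (Fin n) (Fin n) ℝ :=
  Matrix.of fun i j =>
    if i.val = j.val then 1 else if i.val = j.val + 1 then -2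
    else if i.val = j.val + 2 then 1 else 0

/-- The lower triangular Toeplitz matrix with `1, 0, 1` on the main diagonal and on the first two
subdiagonals. -/
def B₂ (n : ℕ) : Matrix (Fin n) (Fin n) ℝ :=
  Matrix.of fun i j =>
    if i.val = j.val then 1 else if i.val = j.val + 2 then 1 else 0

/-- `diag(1/2, 1, …, 1)`. -/
def IHat (n : ℕ) : Matrix (Fin n) (Fin n) ℝ :=
  Matrix.diagonal fun i => if i.val = 0 then 1 / 2 else 1

/-- `diag(1, …, 1, 1/2)`. -/
def ICheck (n : ℕ) : Matrix (Fin n) (Fin n) ℝ :=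
  Matrix.diagonal fun i => if i.val + 1 = n then 1 / 2 else 1

/-- The parameter `α = τ² / √γ`. -/
def alpha (τ γ : ℝ) : ℝ := τ ^ 2 / Real.sqrt γ

/-- `𝒯 = B_n^{(1)} ⊗ I_m - (τ²/2) B_n^{(2)} ⊗ Δ_m`. -/
def waveT {m : ℕ} (τ : ℝ) (Δ : Matrix (Fin m) (Fin m) ℝ) (n : ℕ) :
    Matrix (Fin n × Fin m) (Fin n × Fin m) ℝ :=
  B₁ n ⊗ₖ (1 : Matrix (Fin m) (Fin m) ℝ) - (τ ^ 2 / 2) • (B₂ n ⊗ₖ Δ)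

/-- The saddle point matrix `𝒜`, of order `2mn`. -/
def waveA {m : ℕ} (τ γ : ℝ) (Δ : Matrix (Fin m) (Fin m) ℝ) (n : ℕ) :
    Matrix ((Fin n × Fin m) ⊕ (Fin n × Fin m)) ((Fin n × Fin m) ⊕ (Fin n × Fin m)) ℝ :=
  Matrix.fromBlocks
    (alpha τ γ • (ICheck n ⊗ₖ (1 : Matrix (Fin m) (Fin m) ℝ))) (waveT τ Δ n)ᵀ
    (waveT τ Δ n) (-(alpha τ γ • (IHat n ⊗ₖ (1 : Matrix (Fin m) (Fin m) ℝ))))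

/-- `L_m = I_m - (τ²/2) Δ_m`. -/
def waveL {m : ℕ} (τ : ℝ) (Δ : Matrix (Fin m) (Fin m) ℝ) : Matrix (Fin m) (Fin m) ℝ :=
  1 - (τ ^ 2 / 2) • Δ

/-- `h(θ) = L_m - 2 I_m e^{iθ} + L_m e^{2iθ}`. -/
def waveH {m : ℕ} (τ : ℝ) (Δ : Matrix (Fin m) (Fin m) ℝ) (θ : ℝ) : Matrix (Fin m) (Fin m) ℂ :=
  (waveL τ Δ).map Complex.ofReal
    - (2 * Complex.exp (Complex.I * (θ : ℂ))) • (1 : Matrix (Fin m) (Fin m) ℂ)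
    + Complex.exp (2 * Complex.I * (θ : ℂ)) • (waveL τ Δ).map Complex.ofReal

/-- `|M| = (M^* M)^{1/2}`. -/
def matrixAbs {m : ℕ} (M : Matrix (Fin m) (Fin m) ℂ) : Matrix (Fin m) (Fin m) ℂ :=
  CFC.sqrt (Mᴴ * M)

/-- `g = √(|h|² + α² I_m)`. -/
def waveG {m : ℕ} (τ γ : ℝ) (Δ : Matrix (Fin m) (Fin m) ℝ) (θ : ℝ) :
    Matrix (Fin m) (Fin m) ℂ :=
  CFC.sqrt (matrixAbs (waveH τ Δ θ) ^ 2
    + ((alpha τ γ : ℂ) ^ 2) • (1 : Matrix (Fin m) (Fin m) ℂ))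

end WaveControl

end

/-!
Let `U` be an orthogonal matrix with `Uᵀ Δ U` diagonal, with entries `d j`. Conjugation by
`1 ⊗ U` and a permutation turn `waveA τ γ Δ n` into a block diagonal matrix whose `m` blocks
`scalarA a c n`, of order `2n`, have the same shape with `-(τ²/2) Δ` replaced by the number
`c = -(τ²/2) d j` (`charpoly_waveA`). The same `U` diagonalises the symbol, with eigenvalues
`scalarG a c θ = √(a² + (2 (1 + c) cos θ - 2)²)` (`waveG_eq`). So the claim reduces to the
distribution of the eigenvalues of `scalarA a c n` (`tendsto_mean_roots_scalarA`).

The row sums of `scalarA a c n` are bounded independently of `n`, so its real eigenvalues stay in a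
fixed interval, and by the Weierstrass theorem it is enough to find the limits of the moments
`tr (scalarA a c n ^ k) / 2n` (`tendsto_of_tendsto_moments`). Replacing the nilpotent shift by the
cyclic shift `S`, and the two corner entries `1/2` by `1`, changes entries of bounded total
absolute value, hence each moment by `O(1/n)` (`abs_trace_pow_sub_trace_pow_le`,
`entrySum_scalarA_sub_circA_le`).

The resulting matrix `circA a c n` has a normal block `S ((1 + c) (S + S⁻¹) - 2)`, hence its square
is block diagonal with both blocks equal to `q(S + S⁻¹)`, where `q(x) = a² + ((1 + c) x - 2)²`
(`circA_sq`). Odd moments vanish, and even ones are traces of polynomials in `S + S⁻¹`. Once `n`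
exceeds the degree of `p`, the binomial theorem gives
`tr p(S + S⁻¹) = (n / 2π) ∫ p(2 cos θ) dθ` exactly (`trace_aeval_cycAdj`), and
`q(2 cos θ) = scalarG a c θ ^ 2`.
-/

namespace WaveControl

/-! ### Fourier integrals and the method of moments -/

theorem integral_cexp_int (k : ℤ) (a : ℝ) :
    ∫ θ in a..(a + 2 * Real.pi), Complex.exp (Complex.I * k * (θ : ℂ))
      = if k = 0 then 2 * (Real.pi : ℂ) else 0 := by
  split_ifs with hk
  · simp [hk]
  · have hc : Complex.I * (k : ℂ) ≠ 0 :=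
      mul_ne_zero Complex.I_ne_zero (Int.cast_ne_zero.mpr hk)
    rw [integral_exp_mul_complex hc, div_eq_zero_iff, sub_eq_zero]
    refine Or.inl (Complex.exp_eq_exp_iff_exists_int.mpr ⟨k, ?_⟩)
    push_cast
    ring

theorem exists_complex_polynomial_near (f : C(ℝ, ℂ)) (R : ℝ) {ε : ℝ} (hε : 0 < ε) :
    ∃ p : Polynomial ℂ, ∀ x ∈ Set.Icc (-R) R, ‖f x - p.eval (x : ℂ)‖ ≤ ε := by
  obtain ⟨p, hp⟩ := exists_polynomial_near_of_continuousOn (-R) R (fun x => (f x).re)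
    (by fun_prop) (ε / 2) (by positivity)
  obtain ⟨q, hq⟩ := exists_polynomial_near_of_continuousOn (-R) R (fun x => (f x).im)
    (by fun_prop) (ε / 2) (by positivity)
  refine ⟨p.map Complex.ofRealHom + Polynomial.C Complex.I * q.map Complex.ofRealHom, ?_⟩
  intro x hx
  have h₁ : (p.map Complex.ofRealHom).eval (x : ℂ) = ((p.eval x : ℝ) : ℂ) :=
    Polynomial.eval_map_apply Complex.ofRealHom x
  have h₂ : (q.map Complex.ofRealHom).eval (x : ℂ) = ((q.eval x : ℝ) : ℂ) :=
    Polynomial.eval_map_apply Complex.ofRealHom x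
  rw [Polynomial.eval_add, Polynomial.eval_mul, Polynomial.eval_C, h₁, h₂]
  refine (Complex.norm_le_abs_re_add_abs_im _).trans ?_
  have a := hp x hx
  have b := hq x hx
  rw [abs_sub_comm] at a b
  simp only [Complex.sub_re, Complex.add_re, Complex.mul_re, Complex.ofReal_re, Complex.I_re,
    Complex.I_im, Complex.ofReal_im, Complex.sub_im, Complex.add_im, Complex.mul_im, zero_mul,
    mul_zero, one_mul, sub_zero, add_zero, zero_add]
  linarith

/-- The inclusion of `ℝ` in `ℂ` as a continuous function; its powers are the monomials. -/
def ofRealMap : C(ℝ, ℂ) := ⟨Complex.ofReal, Complex.continuous_ofReal⟩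

/-- Method of moments on a compact interval: if linear functionals `Φ n` and `Ψ` on the continuous
functions are bounded by the sup norm over one and the same `[-R, R]`, then convergence on the
monomials gives convergence on every continuous function, by the Weierstrass theorem. -/
theorem tendsto_of_tendsto_moments (Φ : ℕ → C(ℝ, ℂ) →ₗ[ℂ] ℂ) (Ψ : C(ℝ, ℂ) →ₗ[ℂ] ℂ) (R : ℝ)
    (hΦ : ∀ n, ∀ f : C(ℝ, ℂ), ∀ ε : ℝ, 0 ≤ ε → (∀ x ∈ Set.Icc (-R) R, ‖f x‖ ≤ ε) → ‖Φ n f‖ ≤ ε)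
    (hΨ : ∀ f : C(ℝ, ℂ), ∀ ε : ℝ, 0 ≤ ε → (∀ x ∈ Set.Icc (-R) R, ‖f x‖ ≤ ε) → ‖Ψ f‖ ≤ ε)
    (h : ∀ k : ℕ, Tendsto (fun n => Φ n (ofRealMap ^ k)) atTop (𝓝 (Ψ (ofRealMap ^ k))))
    (f : C(ℝ, ℂ)) : Tendsto (fun n => Φ n f) atTop (𝓝 (Ψ f)) := by
  have hpoly : ∀ p : Polynomial ℂ, Tendsto (fun n => Φ n (Polynomial.aeval ofRealMap p)) atTop
      (𝓝 (Ψ (Polynomial.aeval ofRealMap p))) := by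
    intro p
    simp only [Polynomial.aeval_eq_sum_range, map_sum, map_smul]
    exact tendsto_finsetSum _ fun k _ => (h k).const_smul _
  rw [Metric.tendsto_nhds]
  intro ε hε
  obtain ⟨p, hp⟩ := exists_complex_polynomial_near f R (ε := ε / 4) (by positivity)
  filter_upwards [Metric.tendsto_nhds.mp (hpoly p) (ε / 4) (by positivity)] with n hn
  set P : C(ℝ, ℂ) := Polynomial.aeval ofRealMap p
  have hP : ∀ x ∈ Set.Icc (-R) R, ‖(f - P) x‖ ≤ ε / 4 := by
    intro x hx
    have : P x = p.eval (x : ℂ) := by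
      simp [P, Polynomial.aeval_eq_sum_range, Polynomial.eval_eq_sum_range, ofRealMap]
    rw [ContinuousMap.sub_apply, this]
    exact hp x hx
  have e₁ := hΦ n (f - P) (ε / 4) (by positivity) hP
  have e₂ := hΨ (f - P) (ε / 4) (by positivity) hP
  rw [dist_eq_norm] at hn ⊢
  calc ‖Φ n f - Ψ f‖ = ‖Φ n (f - P) + (Φ n P - Ψ P) - Ψ (f - P)‖ := by
        rw [map_sub, map_sub]; ring_nf
    _ ≤ ‖Φ n (f - P)‖ + ‖Φ n P - Ψ P‖ + ‖Ψ (f - P)‖ :=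
        (norm_sub_le _ _).trans (by gcongr; exact norm_add_le _ _)
    _ < ε := by linarith

/-! ### Traces of powers under perturbation of few entries -/

/-- The complex characteristic roots of a real symmetric matrix are its real eigenvalues. -/
theorem sum_map_roots_charpoly {ι : Type*} [Fintype ι] [DecidableEq ι] {A : Matrix ι ι ℝ}
    (hA : A.IsHermitian) (f : ℂ → ℂ) :
    ((A.map Complex.ofReal).charpoly.roots.map f).sum = ∑ i, f (hA.eigenvalues i : ℂ) := by
  have h : (A.map Complex.ofReal).charpoly
      = ∏ i, (Polynomial.X - Polynomial.C (hA.eigenvalues i : ℂ)) := by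
    have h₁ : (A.map Complex.ofReal).charpoly = A.charpoly.map Complex.ofRealHom :=
      Matrix.charpoly_map A Complex.ofRealHom
    rw [h₁, hA.charpoly_eq, Polynomial.map_prod]
    simp
  rw [h, Polynomial.roots_prod _ _ (Finset.prod_ne_zero_iff.mpr fun i _ =>
    Polynomial.X_sub_C_ne_zero _)]
  simp

theorem trace_pow_eq_sum_eigenvalues {ι : Type*} [Fintype ι] [DecidableEq ι] {A : Matrix ι ι ℝ}
    (hA : A.IsHermitian) (k : ℕ) : (A ^ k).trace = ∑ i, hA.eigenvalues i ^ k := by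
  conv_lhs => rw [hA.spectral_theorem, ← map_pow, Unitary.conjStarAlgAut_apply,
    Matrix.trace_mul_comm, ← mul_assoc]
  simp [Matrix.diagonal_pow, Matrix.trace_diagonal]

section RowSumNorm

-- The norm is the maximal absolute row sum.
attribute [local instance] Matrix.linftyOpNormedRing Matrix.linftyOpNormedAlgebra

variable {ι : Type*} [Fintype ι] [DecidableEq ι]

theorem linfty_norm_le {κ : Type*} [Fintype κ] [DecidableEq κ] {X : Matrix κ κ ℝ} {K : ℝ}
    (hK : 0 ≤ K) (h : ∀ i, ∑ j, |X i j| ≤ K) : ‖X‖ ≤ K := by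
  lift K to NNReal using hK
  rw [Matrix.linfty_opNorm_def, NNReal.coe_le_coe]
  refine Finset.sup_le fun i _ => ?_
  rw [← NNReal.coe_le_coe]
  simpa using h i

theorem sum_abs_le_linfty_norm (X : Matrix ι ι ℝ) (i : ι) : ∑ j, |X i j| ≤ ‖X‖ := by
  rw [Matrix.linfty_opNorm_def]
  have := Finset.le_sup (f := fun i => ∑ j, ‖X i j‖₊) (Finset.mem_univ i)
  rw [← NNReal.coe_le_coe] at this
  simpa using this

theorem abs_apply_le_linfty_norm (X : Matrix ι ι ℝ) (i j : ι) : |X i j| ≤ ‖X‖ :=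
  (Finset.single_le_sum (f := fun j => |X i j|) (fun _ _ => abs_nonneg _)
    (Finset.mem_univ j)).trans (sum_abs_le_linfty_norm X i)

theorem linfty_norm_one_le : ‖(1 : Matrix ι ι ℝ)‖ ≤ 1 :=
  linfty_norm_le zero_le_one fun i => by simp [Matrix.one_apply, apply_ite abs]

theorem abs_eigenvalues_le {A : Matrix ι ι ℝ} (hA : A.IsHermitian) (i : ι) :
    |hA.eigenvalues i| ≤ ‖A‖ := by
  have h := spectrum.norm_le_norm_mul_of_mem (hA.eigenvalues_mem_spectrum_real i)
  exact h.trans (mul_le_of_le_one_right (norm_nonneg _) linfty_norm_one_le)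

/-- The sum of the absolute values of all entries. -/
def entrySum {κ : Type*} [Fintype κ] (X : Matrix κ κ ℝ) : ℝ := ∑ i, ∑ j, |X i j|

theorem entrySum_nonneg {κ : Type*} [Fintype κ] (X : Matrix κ κ ℝ) : 0 ≤ entrySum X :=
  Finset.sum_nonneg fun _ _ => Finset.sum_nonneg fun _ _ => abs_nonneg _

theorem entrySum_add_le {κ : Type*} [Fintype κ] (X Y : Matrix κ κ ℝ) :
    entrySum (X + Y) ≤ entrySum X + entrySum Y := by
  simp only [entrySum, ← Finset.sum_add_distrib]
  exact Finset.sum_le_sum fun _ _ => Finset.sum_le_sum fun _ _ => abs_add_le _ _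

theorem entrySum_smul {κ : Type*} [Fintype κ] (c : ℝ) (X : Matrix κ κ ℝ) :
    entrySum (c • X) = |c| * entrySum X := by
  simp [entrySum, abs_mul, Finset.mul_sum]

theorem entrySum_transpose {κ : Type*} [Fintype κ] (X : Matrix κ κ ℝ) :
    entrySum Xᵀ = entrySum X := Finset.sum_comm

theorem entrySum_fromBlocks {κ : Type*} [Fintype κ] (X Y Z W : Matrix κ κ ℝ) :
    entrySum (Matrix.fromBlocks X Y Z W) = entrySum X + entrySum Y + (entrySum Z + entrySum W) := by
  simp only [entrySum, Fintype.sum_sum_type, Finset.sum_add_distrib, Matrix.fromBlocks_apply₁₁,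
    Matrix.fromBlocks_apply₁₂, Matrix.fromBlocks_apply₂₁, Matrix.fromBlocks_apply₂₂]
  ring

theorem abs_trace_mul_le (X Z : Matrix ι ι ℝ) : |(X * Z).trace| ≤ entrySum X * ‖Z‖ := by
  simp only [Matrix.trace, Matrix.diag, Matrix.mul_apply, entrySum, Finset.sum_mul]
  refine (Finset.abs_sum_le_sum_abs _ _).trans (Finset.sum_le_sum fun i _ => ?_)
  refine (Finset.abs_sum_le_sum_abs _ _).trans (Finset.sum_le_sum fun j _ => ?_)
  rw [abs_mul]
  exact mul_le_mul_of_nonneg_left (abs_apply_le_linfty_norm Z j i) (abs_nonneg _)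

/-- Telescoping `X ^ (k + 1) - Y ^ (k + 1) = X ^ k * (X - Y) + (X ^ k - Y ^ k) * Y` under the trace.
The extra factor `Z` makes the induction work. -/
theorem abs_trace_pow_sub_pow_mul_le {X Y : Matrix ι ι ℝ} {K : ℝ} (hK : 1 ≤ K) (hX : ‖X‖ ≤ K)
    (hY : ‖Y‖ ≤ K) (k : ℕ) (Z : Matrix ι ι ℝ) :
    |((X ^ k - Y ^ k) * Z).trace| ≤ k * K ^ k * entrySum (X - Y) * ‖Z‖ := by
  induction k generalizing Z with
  | zero => simp
  | succ k ih =>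
    have hsplit : ((X ^ (k + 1) - Y ^ (k + 1)) * Z).trace
        = ((X - Y) * (Z * X ^ k)).trace + ((X ^ k - Y ^ k) * (Y * Z)).trace := by
      rw [← mul_assoc (X - Y), Matrix.trace_mul_comm _ (X ^ k), ← Matrix.trace_add]
      congr 1
      rw [pow_succ, pow_succ]
      noncomm_ring
    have hpow : ‖X ^ k‖ ≤ K ^ k := by
      rcases k.eq_zero_or_pos with rfl | hk
      · simpa using linfty_norm_one_le
      · exact (norm_pow_le' X hk).trans (pow_le_pow_left₀ (norm_nonneg _) hX k)
    have hE := entrySum_nonneg (X - Y)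
    have h₁ : |((X - Y) * (Z * X ^ k)).trace| ≤ entrySum (X - Y) * (‖Z‖ * K ^ k) :=
      (abs_trace_mul_le _ _).trans (mul_le_mul_of_nonneg_left
        ((norm_mul_le _ _).trans (by gcongr)) hE)
    have h₂ : |((X ^ k - Y ^ k) * (Y * Z)).trace|
        ≤ k * K ^ k * entrySum (X - Y) * (K * ‖Z‖) :=
      (ih _).trans (mul_le_mul_of_nonneg_left ((norm_mul_le _ _).trans (by gcongr))
        (by positivity))
    have h₃ : K ^ k ≤ K ^ (k + 1) := pow_le_pow_right₀ hK k.le_succ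
    rw [hsplit]
    calc _ ≤ entrySum (X - Y) * (‖Z‖ * K ^ k) + k * K ^ k * entrySum (X - Y) * (K * ‖Z‖) :=
          (abs_add_le _ _).trans (add_le_add h₁ h₂)
      _ ≤ entrySum (X - Y) * (‖Z‖ * K ^ (k + 1)) + k * K ^ k * entrySum (X - Y) * (K * ‖Z‖) := by
          gcongr
      _ = _ := by push_cast; ring

/-- Changing boundedly many entries of a matrix changes the traces of its powers by a bounded
amount, uniformly in the size of the matrix. -/
theorem abs_trace_pow_sub_trace_pow_le {X Y : Matrix ι ι ℝ} {K : ℝ} (hK : 1 ≤ K) (hX : ‖X‖ ≤ K)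
    (hY : ‖Y‖ ≤ K) (k : ℕ) :
    |(X ^ k).trace - (Y ^ k).trace| ≤ k * K ^ k * entrySum (X - Y) := by
  have h := abs_trace_pow_sub_pow_mul_le hK hX hY k 1
  rw [mul_one, Matrix.trace_sub] at h
  have hE := entrySum_nonneg (X - Y)
  exact h.trans (mul_le_of_le_one_right (by positivity) linfty_norm_one_le)

/-- Only the row sums of the four blocks matter, so a common bound on them suffices. -/
theorem linfty_norm_fromBlocks_le {X Y Z W : Matrix ι ι ℝ} {K₁ K₂ : ℝ}
    (hX : ‖X‖ ≤ K₁) (hY : ‖Y‖ ≤ K₂) (hZ : ‖Z‖ ≤ K₂) (hW : ‖W‖ ≤ K₁) :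
    ‖Matrix.fromBlocks X Y Z W‖ ≤ K₁ + K₂ := by
  have h₁ : 0 ≤ K₁ := (norm_nonneg _).trans hX
  have h₂ : 0 ≤ K₂ := (norm_nonneg _).trans hY
  refine linfty_norm_le (by positivity) fun i => ?_
  rw [Fintype.sum_sum_type]
  rcases i with i | i
  · exact add_le_add ((sum_abs_le_linfty_norm X i).trans hX)
      ((sum_abs_le_linfty_norm Y i).trans hY)
  · rw [add_comm]
    exact add_le_add ((sum_abs_le_linfty_norm W i).trans hW)
      ((sum_abs_le_linfty_norm Z i).trans hZ)

end RowSumNorm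

/-! ### Shift matrices -/

/-- The `n × n` matrix with ones on the `k`-th subdiagonal and zeros elsewhere. -/
def nilShift (n k : ℕ) : Matrix (Fin n) (Fin n) ℝ :=
  Matrix.of fun i j => if i.val = j.val + k then 1 else 0

/-- The `k`-th power of the `n × n` cyclic shift, for `k : ℤ`; the condition `i ≡ j + k (mod n)` is
expressed in `ZMod n`. -/
def cycShift (n : ℕ) (k : ℤ) : Matrix (Fin n) (Fin n) ℝ :=
  Matrix.of fun i j => if ((i.val : ZMod n)) = (j.val : ZMod n) + (k : ZMod n) then 1 else 0

theorem natCast_val_injective {n : ℕ} {i j : Fin n}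
    (h : ((i.val : ZMod n)) = (j.val : ZMod n)) : i = j :=
  Fin.ext (((ZMod.natCast_eq_natCast_iff _ _ _).mp h).eq_of_lt_of_lt i.isLt j.isLt)

theorem cycShift_zero (n : ℕ) : cycShift n 0 = 1 := by
  ext i j
  rw [cycShift, Matrix.of_apply, Matrix.one_apply, Int.cast_zero, add_zero]
  exact if_congr ⟨natCast_val_injective, fun h => by rw [h]⟩ rfl rfl

theorem cycShift_mul (n : ℕ) (a b : ℤ) : cycShift n a * cycShift n b = cycShift n (a + b) := by
  ext i j
  have : NeZero n := ⟨i.pos.ne'⟩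
  obtain ⟨l, hl⟩ : ∃ l : Fin n, (l.val : ZMod n) = (j.val : ZMod n) + (b : ZMod n) :=
    ⟨⟨_, ZMod.val_lt ((j.val : ZMod n) + (b : ZMod n))⟩, ZMod.natCast_zmod_val _⟩
  rw [Matrix.mul_apply, Finset.sum_eq_single l]
  · simp only [cycShift, Matrix.of_apply, hl, if_true, mul_one]
    congr 2
    push_cast
    ring
  · intro l' _ hne
    have : ¬ (l'.val : ZMod n) = (j.val : ZMod n) + (b : ZMod n) := fun h =>
      hne (natCast_val_injective (h.trans hl.symm))
    simp [cycShift, this]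
  · simp

theorem cycShift_pow (n : ℕ) (a : ℤ) (k : ℕ) : cycShift n a ^ k = cycShift n (k * a) := by
  induction k with
  | zero => simp [cycShift_zero]
  | succ k ih => rw [pow_succ, ih, cycShift_mul]; congr 1; push_cast; ring

theorem transpose_cycShift (n : ℕ) (k : ℤ) : (cycShift n k)ᵀ = cycShift n (-k) := by
  ext i j
  rw [Matrix.transpose_apply, cycShift, cycShift, Matrix.of_apply, Matrix.of_apply]
  refine if_congr ?_ rfl rfl
  rw [Int.cast_neg, ← sub_eq_add_neg, eq_sub_iff_add_eq, eq_comm]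

theorem trace_cycShift (n : ℕ) (k : ℤ) :
    (cycShift n k).trace = if (n : ℤ) ∣ k then (n : ℝ) else 0 := by
  simp [Matrix.trace, cycShift, ← ZMod.intCast_zmod_eq_zero_iff_dvd]

/-- A row of zeros and ones with at most one entry `1` has row sum at most `1`. -/
theorem sum_abs_ite_le_one {κ : Type*} [Fintype κ] {p : κ → Prop} [DecidablePred p]
    (h : ∀ a b, p a → p b → a = b) : ∑ j, |if p j then (1 : ℝ) else 0| ≤ 1 := by
  simp only [apply_ite abs, abs_one, abs_zero, Finset.sum_boole]
  exact_mod_cast Finset.card_le_one.mpr fun a ha b hb =>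
    h a b (Finset.mem_filter.mp ha).2 (Finset.mem_filter.mp hb).2

theorem sum_abs_cycShift_col_le (n : ℕ) (k : ℤ) (j : Fin n) : ∑ i, |cycShift n k i j| ≤ 1 :=
  sum_abs_ite_le_one fun _ _ ha hb => natCast_val_injective (ha.trans hb.symm)

/-- The two shifts differ only in the last `k` columns, where the cyclic one wraps around. -/
theorem entrySum_nilShift_sub_cycShift_le (n k : ℕ) :
    entrySum (nilShift n k - cycShift n k) ≤ k := by
  rw [← entrySum_transpose]
  have hcol : ∀ j : Fin n, ∑ i, |(nilShift n k - cycShift n k)ᵀ j i|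
      ≤ if n ≤ j.val + k then 1 else 0 := by
    intro j
    split_ifs with hj
    · refine le_trans (le_of_eq (Finset.sum_congr rfl fun i _ => ?_))
        (sum_abs_cycShift_col_le n k j)
      have : ¬ i.val = j.val + k := by omega
      simp [nilShift, this]
    · refine (Finset.sum_eq_zero fun i _ => ?_).le
      rw [abs_eq_zero, Matrix.transpose_apply, Matrix.sub_apply, sub_eq_zero, nilShift, cycShift,
        Matrix.of_apply, Matrix.of_apply]
      refine if_congr ⟨fun h => by rw [h]; push_cast; rfl, fun h => ?_⟩ rfl rfl
      have h' : ((i.val : ℕ) : ZMod n) = ((j.val + k : ℕ) : ZMod n) := by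
        rw [h]; push_cast; rfl
      exact ((ZMod.natCast_eq_natCast_iff _ _ _).mp h').eq_of_lt_of_lt i.isLt (by omega)
  refine (Finset.sum_le_sum fun j _ => hcol j).trans ?_
  rw [Finset.sum_boole, Nat.cast_le, ← Finset.card_map Fin.valEmbedding]
  calc _ ≤ (Finset.Ico (n - k) n).card := Finset.card_le_card fun a ha => by
        obtain ⟨j, hj, rfl⟩ := Finset.mem_map.mp ha
        have := (Finset.mem_filter.mp hj).2
        have := j.isLt
        simp only [Fin.valEmbedding_apply, Finset.mem_Ico]
        omega
    _ ≤ k := by rw [Nat.card_Ico]; omega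

section RowSumNorm

attribute [local instance] Matrix.linftyOpNormedRing Matrix.linftyOpNormedAlgebra

theorem linfty_norm_cycShift_le (n : ℕ) (k : ℤ) : ‖cycShift n k‖ ≤ 1 :=
  linfty_norm_le zero_le_one fun _ => sum_abs_ite_le_one fun _ _ ha hb =>
    natCast_val_injective (add_right_cancel (ha.symm.trans hb))

theorem linfty_norm_nilShift_le (n k : ℕ) : ‖nilShift n k‖ ≤ 1 :=
  linfty_norm_le zero_le_one fun _ => sum_abs_ite_le_one fun _ _ ha hb =>
    Fin.ext (add_right_cancel (ha.symm.trans hb))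

theorem linfty_norm_transpose_nilShift_le (n k : ℕ) : ‖(nilShift n k)ᵀ‖ ≤ 1 :=
  linfty_norm_le zero_le_one fun _ => sum_abs_ite_le_one fun _ _ ha hb =>
    Fin.ext (ha.trans hb.symm)

end RowSumNorm

/-- The circulant matrix `S + S⁻¹`, with `S` the cyclic shift. -/
def cycAdj (n : ℕ) : Matrix (Fin n) (Fin n) ℝ := cycShift n 1 + cycShift n (-1)

/-- Both sides are expanded by the binomial theorem, into shifts `S ^ (2 i - k)` on the left and into
exponentials `exp (I (2 i - k) θ)` on the right; only the terms with `2 i = k` survive. -/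
theorem trace_cycAdj_pow (n k : ℕ) (hk : k < n) :
    ((cycAdj n ^ k).trace : ℂ) = (n / (2 * Real.pi)) *
      ∫ θ in (0 : ℝ)..(2 * Real.pi), ((2 * Real.cos θ : ℝ) : ℂ) ^ k := by
  have hpi : (Real.pi : ℂ) ≠ 0 := Complex.ofReal_ne_zero.mpr Real.pi_ne_zero
  have hcomm : Commute (cycShift n 1) (cycShift n (-1)) := by
    rw [Commute, SemiconjBy, cycShift_mul, cycShift_mul, add_comm]
  have hexp : ∀ θ : ℝ, ((2 * Real.cos θ : ℝ) : ℂ) ^ k = ∑ i ∈ Finset.range (k + 1),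
      (k.choose i : ℂ) * Complex.exp (Complex.I * ((2 * i - k : ℤ) : ℂ) * (θ : ℂ)) := by
    intro θ
    rw [Complex.ofReal_mul, Complex.ofReal_cos, Complex.ofReal_ofNat, Complex.two_cos, add_pow]
    refine Finset.sum_congr rfl fun i hi => ?_
    have hi' : i ≤ k := Nat.lt_succ_iff.mp (Finset.mem_range.mp hi)
    rw [← Complex.exp_nat_mul, ← Complex.exp_nat_mul, ← Complex.exp_add, mul_comm]
    congr 2
    push_cast [Nat.cast_sub hi']
    ring
  simp only [hexp]
  rw [intervalIntegral.integral_finsetSum fun i _ =>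
    (by fun_prop : Continuous _).intervalIntegrable _ _, cycAdj, hcomm.add_pow, Matrix.trace_sum,
    Complex.ofReal_sum, Finset.mul_sum]
  refine Finset.sum_congr rfl fun i hi => ?_
  have hi' : i ≤ k := Nat.lt_succ_iff.mp (Finset.mem_range.mp hi)
  have hint := integral_cexp_int (2 * i - k) 0
  rw [zero_add] at hint
  rw [intervalIntegral.integral_const_mul, hint, cycShift_pow, cycShift_pow, cycShift_mul,
    ← nsmul_eq_mul', Matrix.trace_smul, trace_cycShift]
  -- Since `|2 i - k| ≤ k < n`, divisibility by `n` means vanishing.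
  have hdvd : (n : ℤ) ∣ (i : ℤ) * 1 + ((k - i : ℕ) : ℤ) * -1 ↔ (2 * i - k : ℤ) = 0 := by
    rw [show (i : ℤ) * 1 + ((k - i : ℕ) : ℤ) * -1 = 2 * i - k by omega]
    refine ⟨fun h => Int.eq_zero_of_abs_lt_dvd h (abs_lt.mpr ⟨by omega, by omega⟩), fun h => ?_⟩
    rw [h]; exact dvd_zero _
  simp only [hdvd]
  split_ifs
  · push_cast [nsmul_eq_mul]
    field_simp
  · simp

/-- The mean eigenvalue of a polynomial in `S + S⁻¹` equals the mean of the
polynomial over its symbol `2 cos θ`, exactly, as soon as `n` exceeds the degree. -/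
theorem trace_aeval_cycAdj (n : ℕ) (p : Polynomial ℝ) (hp : p.natDegree < n) :
    ((Polynomial.aeval (cycAdj n) p).trace : ℂ) = (n / (2 * Real.pi)) *
      ∫ θ in (0 : ℝ)..(2 * Real.pi), ((p.eval (2 * Real.cos θ) : ℝ) : ℂ) := by
  simp only [Polynomial.eval_eq_sum_range, Complex.ofReal_sum, Complex.ofReal_mul,
    Complex.ofReal_pow (2 * _)]
  rw [intervalIntegral.integral_finsetSum fun i _ =>
    (by fun_prop : Continuous _).intervalIntegrable _ _, Polynomial.aeval_eq_sum_range,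
    Matrix.trace_sum, Complex.ofReal_sum, Finset.mul_sum]
  refine Finset.sum_congr rfl fun i hi => ?_
  have hi' : i < n := (Nat.lt_succ_iff.mp (Finset.mem_range.mp hi)).trans_lt hp
  rw [intervalIntegral.integral_const_mul, Matrix.trace_smul, smul_eq_mul, Complex.ofReal_mul,
    trace_cycAdj_pow n i hi']
  simp only [Complex.ofReal_mul]
  ring

/-! ### The scalar problem -/

/-- The scalar analogue of `waveT`, with `-(τ ^ 2 / 2) Δ` replaced by the number `c`. -/
noncomputable def scalarT (c : ℝ) (n : ℕ) : Matrix (Fin n) (Fin n) ℝ := B₁ n + c • B₂ n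

/-- The scalar analogue of `waveA`, with `-(τ ^ 2 / 2) Δ` replaced by the number `c`. -/
noncomputable def scalarA (a c : ℝ) (n : ℕ) : Matrix (Fin n ⊕ Fin n) (Fin n ⊕ Fin n) ℝ :=
  Matrix.fromBlocks (a • ICheck n) (scalarT c n)ᵀ (scalarT c n) (-(a • IHat n))

/-- The circulant analogue of `scalarT`. -/
noncomputable def circT (c : ℝ) (n : ℕ) : Matrix (Fin n) (Fin n) ℝ :=
  (1 + c) • cycShift n 0 + (-2 : ℝ) • cycShift n 1 + (1 + c) • cycShift n 2

/-- The circulant analogue of `scalarA`, with the halved corner entries restored to `1`. -/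
noncomputable def circA (a c : ℝ) (n : ℕ) : Matrix (Fin n ⊕ Fin n) (Fin n ⊕ Fin n) ℝ :=
  Matrix.fromBlocks (a • 1) (circT c n)ᵀ (circT c n) (-(a • 1))

theorem scalarT_eq (c : ℝ) (n : ℕ) : scalarT c n
    = (1 + c) • nilShift n 0 + (-2 : ℝ) • nilShift n 1 + (1 + c) • nilShift n 2 := by
  ext i j
  simp only [scalarT, B₁, B₂, nilShift, Matrix.add_apply, Matrix.smul_apply, Matrix.of_apply,
    smul_eq_mul, add_zero]
  split_ifs <;> first | omega | ring

theorem isHermitian_scalarA (a c : ℝ) (n : ℕ) : (scalarA a c n).IsHermitian := by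
  refine Matrix.IsHermitian.fromBlocks ?_ ?_ ?_ <;>
    simp [Matrix.IsHermitian, ICheck, IHat, Matrix.conjTranspose_eq_transpose_of_trivial]

/-- A bound, independent of `n`, for the absolute row sums of `scalarA a c n` and `circA a c n`, and
for the symbol `scalarG a c`. -/
noncomputable def rowBound (a c : ℝ) : ℝ := |a| + (2 * |1 + c| + 2)

section RowSumNorm

attribute [local instance] Matrix.linftyOpNormedRing Matrix.linftyOpNormedAlgebra

theorem linfty_norm_tridiag_le {n : ℕ} (c : ℝ) {X Y Z : Matrix (Fin n) (Fin n) ℝ}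
    (hX : ‖X‖ ≤ 1) (hY : ‖Y‖ ≤ 1) (hZ : ‖Z‖ ≤ 1) :
    ‖(1 + c) • X + (-2 : ℝ) • Y + (1 + c) • Z‖ ≤ 2 * |1 + c| + 2 := by
  refine (norm_add₃_le).trans ?_
  rw [norm_smul, norm_smul, norm_smul, Real.norm_eq_abs, Real.norm_eq_abs, abs_neg, abs_two]
  have h := abs_nonneg (1 + c)
  nlinarith [norm_nonneg X, norm_nonneg Y, norm_nonneg Z]

theorem linfty_norm_smul_diagonal_le {n : ℕ} (a : ℝ) {v : Fin n → ℝ} (hv : ∀ i, |v i| ≤ 1) :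
    ‖a • Matrix.diagonal v‖ ≤ |a| := by
  rw [norm_smul, Real.norm_eq_abs]
  refine mul_le_of_le_one_right (abs_nonneg _) (linfty_norm_le zero_le_one fun i => ?_)
  simpa [Matrix.diagonal_apply, apply_ite abs] using hv i

theorem linfty_norm_scalarA_le (a c : ℝ) (n : ℕ) : ‖scalarA a c n‖ ≤ rowBound a c := by
  refine linfty_norm_fromBlocks_le ?_ ?_ ?_ ?_
  · exact linfty_norm_smul_diagonal_le a fun i => by split_ifs <;> norm_num [abs_of_pos]
  · rw [scalarT_eq]
    simp only [Matrix.transpose_add, Matrix.transpose_smul]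
    exact linfty_norm_tridiag_le c (linfty_norm_transpose_nilShift_le n 0)
      (linfty_norm_transpose_nilShift_le n 1) (linfty_norm_transpose_nilShift_le n 2)
  · rw [scalarT_eq]
    exact linfty_norm_tridiag_le c (linfty_norm_nilShift_le n 0)
      (linfty_norm_nilShift_le n 1) (linfty_norm_nilShift_le n 2)
  · rw [norm_neg]
    exact linfty_norm_smul_diagonal_le a fun i => by split_ifs <;> norm_num [abs_of_pos]

theorem linfty_norm_circA_le (a c : ℝ) (n : ℕ) : ‖circA a c n‖ ≤ rowBound a c := by
  have h₁ : ‖a • (1 : Matrix (Fin n) (Fin n) ℝ)‖ ≤ |a| := by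
    rw [norm_smul, Real.norm_eq_abs]
    exact mul_le_of_le_one_right (abs_nonneg _) linfty_norm_one_le
  refine linfty_norm_fromBlocks_le h₁ ?_ ?_ (by rwa [norm_neg])
  · simp only [circT, Matrix.transpose_add, Matrix.transpose_smul, transpose_cycShift]
    exact linfty_norm_tridiag_le c (linfty_norm_cycShift_le n _)
      (linfty_norm_cycShift_le n _) (linfty_norm_cycShift_le n _)
  · exact linfty_norm_tridiag_le c (linfty_norm_cycShift_le n _)
      (linfty_norm_cycShift_le n _) (linfty_norm_cycShift_le n _)

end RowSumNorm

theorem entrySum_diagonal_ite_sub_one_le {n : ℕ} {p : Fin n → Prop} [DecidablePred p]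
    (h : ∀ a b, p a → p b → a = b) :
    entrySum (Matrix.diagonal (fun i => if p i then (1 / 2 : ℝ) else 1) - 1) ≤ 1 := by
  refine le_trans (Finset.sum_le_sum fun i _ => ?_) (sum_abs_ite_le_one h)
  rw [Finset.sum_eq_single i]
  · simp only [Matrix.sub_apply, Matrix.diagonal_apply_eq, Matrix.one_apply_eq]
    split_ifs <;> norm_num [abs_of_nonneg, abs_of_neg]
  · intro j _ hj
    simp [Matrix.diagonal_apply_ne' _ hj, Matrix.one_apply_ne' hj]
  · simp

theorem entrySum_scalarT_sub_circT_le (c : ℝ) (n : ℕ) :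
    entrySum (scalarT c n - circT c n) ≤ 2 * |1 + c| + 2 := by
  have h : scalarT c n - circT c n = (1 + c) • (nilShift n 0 - cycShift n (0 : ℕ))
      + (-2 : ℝ) • (nilShift n 1 - cycShift n (1 : ℕ))
      + (1 + c) • (nilShift n 2 - cycShift n (2 : ℕ)) := by
    rw [scalarT_eq, circT]
    simp only [smul_sub, Nat.cast_zero, Nat.cast_one, Nat.cast_ofNat]
    abel
  rw [h]
  refine (entrySum_add_le _ _).trans ((add_le_add (entrySum_add_le _ _) le_rfl).trans ?_)
  rw [entrySum_smul, entrySum_smul, entrySum_smul, abs_neg, abs_two]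
  have h₀ := entrySum_nilShift_sub_cycShift_le n 0
  have h₁ := entrySum_nilShift_sub_cycShift_le n 1
  have h₂ := entrySum_nilShift_sub_cycShift_le n 2
  push_cast at h₀ h₁ h₂ ⊢
  nlinarith [abs_nonneg (1 + c)]

theorem entrySum_scalarA_sub_circA_le (a c : ℝ) (n : ℕ) :
    entrySum (scalarA a c n - circA a c n) ≤ 2 * rowBound a c := by
  have h₁ : entrySum (ICheck n - 1) ≤ 1 :=
    entrySum_diagonal_ite_sub_one_le fun i j hi hj => Fin.ext (by omega)
  have h₂ : entrySum (IHat n - 1) ≤ 1 :=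
    entrySum_diagonal_ite_sub_one_le fun i j hi hj => Fin.ext (by omega)
  have h₃ := entrySum_scalarT_sub_circT_le c n
  have e : -(a • IHat n) - -(a • 1) = (-a) • (IHat n - 1) := by
    rw [neg_smul, smul_sub]; abel
  rw [scalarA, circA, sub_eq_add_neg, Matrix.fromBlocks_neg, Matrix.fromBlocks_add,
    entrySum_fromBlocks, ← sub_eq_add_neg, ← sub_eq_add_neg, ← sub_eq_add_neg, ← sub_eq_add_neg,
    ← Matrix.transpose_sub, entrySum_transpose, ← smul_sub, e, entrySum_smul, entrySum_smul,
    abs_neg, rowBound]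
  nlinarith [abs_nonneg a]

/-- The polynomial `a² + ((1 + c) x - 2)²`; its value at `2 cos θ` is the square of the symbol. -/
noncomputable def symbolPoly (a c : ℝ) : Polynomial ℝ :=
  Polynomial.C (a ^ 2) + (Polynomial.C (1 + c) * Polynomial.X - 2) ^ 2

/-- The symbol of the scalar problem, `√(a² + (2 (1 + c) cos θ - 2)²)`. -/
noncomputable def scalarG (a c θ : ℝ) : ℝ := Real.sqrt (a ^ 2 + (2 * (1 + c) * Real.cos θ - 2) ^ 2)

theorem scalarG_sq (a c θ : ℝ) :
    scalarG a c θ ^ 2 = a ^ 2 + (2 * (1 + c) * Real.cos θ - 2) ^ 2 :=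
  Real.sq_sqrt (by positivity)

theorem scalarG_sq_eq_eval (a c θ : ℝ) :
    scalarG a c θ ^ 2 = (symbolPoly a c).eval (2 * Real.cos θ) := by
  rw [scalarG_sq]
  simp only [symbolPoly, Polynomial.eval_add, Polynomial.eval_pow, Polynomial.eval_sub,
    Polynomial.eval_mul, Polynomial.eval_C, Polynomial.eval_X, Polynomial.eval_ofNat]
  ring

@[fun_prop]
theorem continuous_scalarG (a c : ℝ) : Continuous (scalarG a c) := by
  unfold scalarG; fun_prop

theorem scalarG_nonneg (a c θ : ℝ) : 0 ≤ scalarG a c θ := Real.sqrt_nonneg _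

theorem scalarG_le (a c θ : ℝ) : scalarG a c θ ≤ rowBound a c := by
  have h : |2 * (1 + c) * Real.cos θ - 2| ≤ 2 * |1 + c| + 2 := by
    refine (abs_sub _ _).trans ?_
    rw [abs_mul, abs_mul, abs_two]
    have := mul_le_of_le_one_right (by positivity : 0 ≤ 2 * |1 + c|) (Real.abs_cos_le_one θ)
    linarith
  refine (Real.sqrt_le_sqrt (y := (|a| + |2 * (1 + c) * Real.cos θ - 2|) ^ 2) ?_).trans ?_
  · rw [add_sq, sq_abs, sq_abs]
    have := mul_nonneg (abs_nonneg a) (abs_nonneg (2 * (1 + c) * Real.cos θ - 2))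
    linarith
  · rw [Real.sqrt_sq (by positivity), rowBound]
    linarith

theorem trace_fromBlocks {n : ℕ} (X Y Z W : Matrix (Fin n) (Fin n) ℝ) :
    (Matrix.fromBlocks X Y Z W).trace = X.trace + W.trace := by
  simp [Matrix.trace, Fintype.sum_sum_type]

/-- Squaring cancels the off-diagonal blocks because `circT` is normal. -/
theorem circA_sq (a c : ℝ) (n : ℕ) : circA a c n ^ 2 = Matrix.fromBlocks
    (Polynomial.aeval (cycAdj n) (symbolPoly a c)) 0 0
    (Polynomial.aeval (cycAdj n) (symbolPoly a c)) := by
  set E : Matrix (Fin n) (Fin n) ℝ := (1 + c) • cycAdj n - (2 : ℝ) • 1 with hE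
  have hT : circT c n = cycShift n 1 * E := by
    -- `(1 + c) - 2 S + (1 + c) S² = S ((1 + c) (S + S⁻¹) - 2)`
    rw [hE, cycAdj, mul_sub, mul_smul_comm, mul_add, cycShift_mul, cycShift_mul, mul_smul_comm,
      mul_one, circT, smul_add]
    norm_num
    abel
  have hET : Eᵀ = E := by
    simp only [hE, cycAdj, Matrix.transpose_sub, Matrix.transpose_smul, Matrix.transpose_add,
      transpose_cycShift, neg_neg, Matrix.transpose_one, add_comm]
  have hTT : (circT c n)ᵀ = E * cycShift n (-1) := by
    rw [hT, Matrix.transpose_mul, hET, transpose_cycShift]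
  have hcomm : cycShift n 1 * E = E * cycShift n 1 := by
    simp only [hE, cycAdj, mul_sub, sub_mul, mul_smul_comm, smul_mul_assoc, mul_add, add_mul,
      cycShift_mul, mul_one, one_mul]
    norm_num
  have h₁ : (circT c n)ᵀ * circT c n = E * E := by
    rw [hTT, hT, mul_assoc, ← mul_assoc (cycShift n (-1)), cycShift_mul, neg_add_cancel,
      cycShift_zero, one_mul]
  have h₂ : circT c n * (circT c n)ᵀ = E * E := by
    rw [hTT, hT, hcomm, mul_assoc, ← mul_assoc (cycShift n 1), hcomm, mul_assoc, cycShift_mul,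
      add_neg_cancel, cycShift_zero, mul_one]
  have hq : Polynomial.aeval (cycAdj n) (symbolPoly a c) = (a ^ 2) • 1 + E * E := by
    rw [symbolPoly, map_add, Polynomial.aeval_C, map_pow (Polynomial.aeval _), map_sub,
      map_mul, Polynomial.aeval_C, Polynomial.aeval_X, map_ofNat, Algebra.algebraMap_eq_smul_one,
      Algebra.algebraMap_eq_smul_one, smul_mul_assoc, one_mul, sq (_ - _), hE, show (OfNat.ofNat 2 : Matrix (Fin n) (Fin n) ℝ) = (2 : ℝ) • 1 by
      rw [two_smul]; exact one_add_one_eq_two.symm]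
  rw [sq, circA, Matrix.fromBlocks_multiply, hq, h₁, h₂]
  congr 1
  · rw [smul_mul_smul_comm, one_mul, sq]
  · simp
  · simp
  · rw [neg_mul_neg, smul_mul_smul_comm, one_mul, sq, add_comm]

theorem circA_pow_two_mul (a c : ℝ) (n j : ℕ) : circA a c n ^ (2 * j) = Matrix.fromBlocks
    (Polynomial.aeval (cycAdj n) (symbolPoly a c ^ j)) 0 0
    (Polynomial.aeval (cycAdj n) (symbolPoly a c ^ j)) := by
  rw [pow_mul, circA_sq, map_pow]
  induction j with
  | zero => simp
  | succ j ih => rw [pow_succ, ih, Matrix.fromBlocks_multiply]; simp [pow_succ]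

theorem natDegree_symbolPoly_pow_le (a c : ℝ) (j : ℕ) :
    (symbolPoly a c ^ j).natDegree ≤ 2 * j := by
  have h : (symbolPoly a c).natDegree ≤ 2 := by
    unfold symbolPoly; compute_degree
  exact (Polynomial.natDegree_pow_le_of_le j h).trans (by omega)

/-- For even `k` the trace is that of a polynomial in `S + S⁻¹`; for odd `k` both sides vanish, since
the two diagonal blocks of `circA a c n` are opposite. -/
theorem trace_circA_pow (a c : ℝ) (n k : ℕ) (hk : k < n) :
    ((circA a c n ^ k).trace : ℂ) = (n / (2 * Real.pi)) * ∫ θ in (0 : ℝ)..(2 * Real.pi),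
      ((scalarG a c θ : ℂ) ^ k + (-scalarG a c θ : ℂ) ^ k) := by
  rcases k.even_or_odd' with ⟨j, rfl | rfl⟩
  · have hG : ∀ θ, (scalarG a c θ : ℂ) ^ (2 * j) + (-scalarG a c θ : ℂ) ^ (2 * j)
        = 2 * (((symbolPoly a c ^ j).eval (2 * Real.cos θ) : ℝ) : ℂ) := by
      intro θ
      rw [Even.neg_pow (even_two_mul j), Polynomial.eval_pow, ← scalarG_sq_eq_eval, pow_mul]
      push_cast
      ring
    simp only [hG]
    rw [circA_pow_two_mul, trace_fromBlocks, intervalIntegral.integral_const_mul,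
      Complex.ofReal_add, trace_aeval_cycAdj n _
        ((natDegree_symbolPoly_pow_le a c j).trans_lt hk)]
    ring
  · have hG : ∀ θ, (scalarG a c θ : ℂ) ^ (2 * j + 1) + (-scalarG a c θ : ℂ) ^ (2 * j + 1) = 0 := by
      intro θ
      rw [Odd.neg_pow (odd_two_mul_add_one j), add_neg_cancel]
    simp only [hG]
    rw [pow_succ, circA_pow_two_mul, circA, Matrix.fromBlocks_multiply, trace_fromBlocks]
    simp

theorem tendsto_trace_scalarA_pow (a c : ℝ) (k : ℕ) :
    Tendsto (fun n : ℕ => (1 / (2 * n : ℂ)) * ((scalarA a c n ^ k).trace : ℂ)) atTop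
      (𝓝 ((1 / (4 * Real.pi)) * ∫ θ in (0 : ℝ)..(2 * Real.pi),
        ((scalarG a c θ : ℂ) ^ k + (-scalarG a c θ : ℂ) ^ k))) := by
  set J : ℂ := ∫ θ in (0 : ℝ)..(2 * Real.pi),
    ((scalarG a c θ : ℂ) ^ k + (-scalarG a c θ : ℂ) ^ k)
  have hK : 1 ≤ rowBound a c := by
    have := abs_nonneg a; have := abs_nonneg (1 + c); unfold rowBound; linarith
  set M : ℝ := k * rowBound a c ^ k * (2 * rowBound a c)
  have hdiff : ∀ n, ‖((scalarA a c n ^ k).trace : ℂ) - ((circA a c n ^ k).trace : ℂ)‖ ≤ M := by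
    intro n
    rw [← Complex.ofReal_sub, Complex.norm_real]
    exact (abs_trace_pow_sub_trace_pow_le hK (linfty_norm_scalarA_le a c n)
      (linfty_norm_circA_le a c n) k).trans
        (mul_le_mul_of_nonneg_left (entrySum_scalarA_sub_circA_le a c n) (by positivity))
  rw [tendsto_iff_norm_sub_tendsto_zero]
  refine squeeze_zero' (Eventually.of_forall fun _ => norm_nonneg _) ?_
    (tendsto_const_div_atTop_nhds_zero_nat M)
  filter_upwards [eventually_gt_atTop k] with n hn
  have hn0 : (n : ℂ) ≠ 0 := Nat.cast_ne_zero.mpr (by omega)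
  have hpi : (Real.pi : ℂ) ≠ 0 := Complex.ofReal_ne_zero.mpr Real.pi_ne_zero
  have hJ : (1 / (4 * Real.pi)) * J = (1 / (2 * n : ℂ)) * ((circA a c n ^ k).trace : ℂ) := by
    rw [trace_circA_pow a c n k hn]
    field_simp
    ring
  rw [hJ, ← mul_sub, norm_mul, div_eq_inv_mul M]
  have hnorm : ‖(1 / (2 * n : ℂ))‖ ≤ (n : ℝ)⁻¹ := by
    rw [one_div, norm_inv, norm_mul, Complex.norm_natCast, Complex.norm_ofNat]
    have : (0 : ℝ) < n := Nat.cast_pos.mpr (by omega)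
    exact inv_anti₀ this (by linarith)
  exact mul_le_mul hnorm (hdiff n) (norm_nonneg _) (by positivity)

/-- The mean of a continuous function over the eigenvalues of `scalarA a c n`; it vanishes for
`n = 0`. -/
noncomputable def eigenvalueMean (a c : ℝ) (n : ℕ) : C(ℝ, ℂ) →ₗ[ℂ] ℂ where
  toFun f := (1 / (2 * n : ℂ)) * ∑ i, f ((isHermitian_scalarA a c n).eigenvalues i)
  map_add' f g := by simp [Finset.sum_add_distrib, mul_add]
  map_smul' r f := by simp [← Finset.mul_sum, mul_left_comm]

/-- The mean of a continuous function over the two branches `±scalarG a c` of the symbol. -/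
noncomputable def symbolMean (a c : ℝ) : C(ℝ, ℂ) →ₗ[ℂ] ℂ where
  toFun f := (1 / (4 * Real.pi)) * ∫ θ in (0 : ℝ)..(2 * Real.pi),
    (f (scalarG a c θ) + f (-scalarG a c θ))
  map_add' f g := by
    rw [← mul_add, ← intervalIntegral.integral_add
      ((by fun_prop : Continuous _).intervalIntegrable _ _)
      ((by fun_prop : Continuous _).intervalIntegrable _ _)]
    simp only [ContinuousMap.add_apply]
    congr 2
    ext θ
    ring
  map_smul' r f := by
    simp only [ContinuousMap.smul_apply, smul_eq_mul, ← mul_add,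
      intervalIntegral.integral_const_mul, RingHom.id_apply]
    ring

/-- The eigenvalue distribution of the scalar problem. -/
theorem tendsto_mean_roots_scalarA (a c : ℝ) (F : C(ℂ, ℂ)) :
    Tendsto (fun n : ℕ => (1 / (2 * n : ℂ)) *
        (((scalarA a c n).map Complex.ofReal).charpoly.roots.map F).sum) atTop
      (𝓝 ((1 / (4 * Real.pi)) * ∫ θ in (0 : ℝ)..(2 * Real.pi),
        (F (scalarG a c θ : ℂ) + F (-scalarG a c θ : ℂ)))) := by
  have hmain := tendsto_of_tendsto_moments (eigenvalueMean a c) (symbolMean a c) (rowBound a c)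
    (fun n f ε hε hf => ?_) (fun f ε hε hf => ?_) (fun k => ?_) (F.comp ofRealMap)
  · have h : symbolMean a c (F.comp ofRealMap) = (1 / (4 * Real.pi)) *
        ∫ θ in (0 : ℝ)..(2 * Real.pi), (F (scalarG a c θ : ℂ) + F (-scalarG a c θ : ℂ)) := by
      simp [symbolMean, ofRealMap]
    rw [← h]
    refine hmain.congr fun n => ?_
    rw [sum_map_roots_charpoly (isHermitian_scalarA a c n)]
    rfl
  · have hsum : ‖∑ i, f ((isHermitian_scalarA a c n).eigenvalues i)‖ ≤ 2 * n * ε := by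
      refine (norm_sum_le_of_le _ fun i _ => hf _ (abs_le.mp
        ((abs_eigenvalues_le _ i).trans (linfty_norm_scalarA_le a c n)))).trans (le_of_eq ?_)
      simp [two_mul]
    change ‖(1 / (2 * n : ℂ)) * _‖ ≤ ε
    rw [norm_mul, one_div, norm_inv, norm_mul, Complex.norm_natCast, Complex.norm_ofNat]
    rcases n.eq_zero_or_pos with rfl | hn
    · simpa using hε
    · have : (0 : ℝ) < n := Nat.cast_pos.mpr hn
      rw [inv_mul_le_iff₀ (by positivity)]
      exact hsum
  · have hle := scalarG_le a c
    have h0 := scalarG_nonneg a c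
    have hint : ‖∫ θ in (0 : ℝ)..(2 * Real.pi), (f (scalarG a c θ) + f (-scalarG a c θ))‖
        ≤ (ε + ε) * |2 * Real.pi - 0| :=
      intervalIntegral.norm_integral_le_of_norm_le_const fun θ _ =>
        norm_add_le_of_le (hf _ ⟨by linarith [hle θ, h0 θ], hle θ⟩)
          (hf _ ⟨by linarith [hle θ], by linarith [hle θ, h0 θ]⟩)
    change ‖(1 / (4 * Real.pi : ℂ)) * _‖ ≤ ε
    have hpi := Real.pi_pos
    rw [norm_mul, one_div, norm_inv, norm_mul, Complex.norm_real, Complex.norm_ofNat,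
      Real.norm_of_nonneg hpi.le, inv_mul_le_iff₀ (by positivity)]
    rw [sub_zero, abs_of_pos (by positivity)] at hint
    linarith
  · have h : symbolMean a c (ofRealMap ^ k) = (1 / (4 * Real.pi)) *
        ∫ θ in (0 : ℝ)..(2 * Real.pi), ((scalarG a c θ : ℂ) ^ k + (-scalarG a c θ : ℂ) ^ k) := by
      simp [symbolMean, ofRealMap]
    rw [h]
    refine (tendsto_trace_scalarA_pow a c k).congr fun n => ?_
    rw [trace_pow_eq_sum_eigenvalues (isHermitian_scalarA a c n)]
    simp [eigenvalueMean, ofRealMap]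

/-! ### Splitting the all-at-once matrix into scalar problems -/

theorem exists_orthogonal_diagonalization {m : ℕ} {Δ : Matrix (Fin m) (Fin m) ℝ}
    (hΔ : Δ.IsHermitian) : ∃ (U : Matrix (Fin m) (Fin m) ℝ) (d : Fin m → ℝ),
      Uᵀ * U = 1 ∧ U * Uᵀ = 1 ∧ Δ = U * Matrix.diagonal d * Uᵀ := by
  refine ⟨hΔ.eigenvectorUnitary, hΔ.eigenvalues, ?_, ?_, ?_⟩
  · exact Unitary.coe_star_mul_self hΔ.eigenvectorUnitary
  · exact Unitary.coe_mul_star_self hΔ.eigenvectorUnitary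
  · exact hΔ.spectral_theorem

theorem charpoly_mul_mul_of_mul_eq_one {ι R : Type*} [Fintype ι] [DecidableEq ι] [CommRing R]
    {V V' : Matrix ι ι R} (h : V' * V = 1) (X : Matrix ι ι R) :
    (V * X * V').charpoly = X.charpoly := by
  rw [Matrix.charpoly_mul_comm, ← mul_assoc, h, one_mul]

theorem charpoly_blockDiagonal {ι κ R : Type*} [Fintype ι] [DecidableEq ι] [Fintype κ]
    [DecidableEq κ] [CommRing R] (M : κ → Matrix ι ι R) :
    (Matrix.blockDiagonal M).charpoly = ∏ k, (M k).charpoly := by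
  have h : (Matrix.blockDiagonal M).charmatrix
      = Matrix.blockDiagonal fun k => (M k).charmatrix := by
    ext1 ⟨i, k⟩ ⟨j, l⟩
    by_cases hkl : k = l
    · subst hkl
      by_cases hij : i = j <;> simp [Matrix.blockDiagonal_apply, hij]
    · simp [Matrix.blockDiagonal_apply, hkl]
  rw [Matrix.charpoly, h, Matrix.det_blockDiagonal]
  rfl

theorem one_kronecker_conj {n m : ℕ} (X : Matrix (Fin n) (Fin n) ℝ)
    (U Y : Matrix (Fin m) (Fin m) ℝ) :
    X ⊗ₖ (U * Y * Uᵀ) = ((1 : Matrix (Fin n) (Fin n) ℝ) ⊗ₖ U) * (X ⊗ₖ Y)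
      * ((1 : Matrix (Fin n) (Fin n) ℝ) ⊗ₖ U)ᵀ := by
  rw [← Matrix.kroneckerMap_transpose, ← Matrix.mul_kronecker_mul, ← Matrix.mul_kronecker_mul,
    Matrix.transpose_one, one_mul, mul_one]

theorem waveA_conj {m : ℕ} (τ γ : ℝ) {U D : Matrix (Fin m) (Fin m) ℝ} (hU : U * Uᵀ = 1) (n : ℕ) :
    waveA τ γ (U * D * Uᵀ) n
      = Matrix.fromBlocks ((1 : Matrix (Fin n) (Fin n) ℝ) ⊗ₖ U) 0 0 (1 ⊗ₖ U) * waveA τ γ D n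
        * Matrix.fromBlocks ((1 : Matrix (Fin n) (Fin n) ℝ) ⊗ₖ U)ᵀ 0 0
            ((1 : Matrix (Fin n) (Fin n) ℝ) ⊗ₖ U)ᵀ := by
  set K := (1 : Matrix (Fin n) (Fin n) ℝ) ⊗ₖ U with hK
  have h₁ : ∀ X : Matrix (Fin n) (Fin n) ℝ, X ⊗ₖ (1 : Matrix (Fin m) (Fin m) ℝ)
      = K * (X ⊗ₖ (1 : Matrix (Fin m) (Fin m) ℝ)) * Kᵀ := fun X => by
    rw [← one_kronecker_conj, mul_one, hU]
  have h₂ : waveT τ (U * D * Uᵀ) n = K * waveT τ D n * Kᵀ := by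
    conv_lhs => rw [waveT, h₁ (B₁ n), one_kronecker_conj, ← hK]
    rw [waveT, mul_sub, sub_mul, mul_smul_comm, smul_mul_assoc]
  rw [waveA, waveA, Matrix.fromBlocks_multiply, Matrix.fromBlocks_multiply, h₂]
  simp only [zero_mul, mul_zero, add_zero, zero_add, Matrix.transpose_mul,
    Matrix.transpose_transpose, mul_smul_comm, smul_mul_assoc, mul_neg, neg_mul, smul_zero,
    neg_zero, ← h₁, ← mul_assoc]

theorem waveA_diagonal {m : ℕ} (τ γ : ℝ) (d : Fin m → ℝ) (n : ℕ) :
    waveA τ γ (Matrix.diagonal d) n = Matrix.reindex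
      (Equiv.sumProdDistrib (Fin n) (Fin n) (Fin m)) (Equiv.sumProdDistrib (Fin n) (Fin n) (Fin m))
      (Matrix.blockDiagonal fun j => scalarA (alpha τ γ) (-(τ ^ 2 / 2) * d j) n) := by
  ext1 x y
  rcases x with ⟨i, k⟩ | ⟨i, k⟩ <;> rcases y with ⟨j, l⟩ | ⟨j, l⟩ <;>
  by_cases h : k = l <;>
  simp [waveA, scalarA, waveT, scalarT, Matrix.blockDiagonal_apply, h, eq_comm (a := l)] <;> ring

/-- In an orthonormal eigenbasis of `Δ` the problem splits into `m` scalar ones. -/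
theorem charpoly_waveA {m : ℕ} (τ γ : ℝ) {U Δ : Matrix (Fin m) (Fin m) ℝ} {d : Fin m → ℝ}
    (hU : Uᵀ * U = 1) (hU' : U * Uᵀ = 1) (hΔ : Δ = U * Matrix.diagonal d * Uᵀ) (n : ℕ) :
    (waveA τ γ Δ n).charpoly
      = ∏ j, (scalarA (alpha τ γ) (-(τ ^ 2 / 2) * d j) n).charpoly := by
  rw [hΔ, waveA_conj τ γ hU', charpoly_mul_mul_of_mul_eq_one, waveA_diagonal,
    Matrix.charpoly_reindex, charpoly_blockDiagonal]
  rw [Matrix.fromBlocks_multiply, ← Matrix.kroneckerMap_transpose, ← Matrix.mul_kronecker_mul, hU]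
  simp

theorem sum_map_roots_waveA {m : ℕ} (τ γ : ℝ) {U Δ : Matrix (Fin m) (Fin m) ℝ} {d : Fin m → ℝ}
    (hU : Uᵀ * U = 1) (hU' : U * Uᵀ = 1) (hΔ : Δ = U * Matrix.diagonal d * Uᵀ) (n : ℕ)
    (F : ℂ → ℂ) :
    (((waveA τ γ Δ n).map Complex.ofReal).charpoly.roots.map F).sum
      = ∑ j, (((scalarA (alpha τ γ) (-(τ ^ 2 / 2) * d j) n).map
          Complex.ofReal).charpoly.roots.map F).sum := by
  have h : ((waveA τ γ Δ n).map Complex.ofReal).charpoly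
      = ∏ j, ((scalarA (alpha τ γ) (-(τ ^ 2 / 2) * d j) n).map Complex.ofReal).charpoly := by
    have h₁ : ((waveA τ γ Δ n).map Complex.ofReal).charpoly
        = (waveA τ γ Δ n).charpoly.map Complex.ofRealHom :=
      Matrix.charpoly_map _ Complex.ofRealHom
    rw [h₁, charpoly_waveA τ γ hU hU' hΔ, Polynomial.map_prod]
    exact Finset.prod_congr rfl fun j _ => (Matrix.charpoly_map _ Complex.ofRealHom).symm
  rw [h, Polynomial.roots_prod _ _ (Finset.prod_ne_zero_iff.mpr fun j _ =>
    (Matrix.charpoly_monic _).ne_zero), Multiset.map_bind, Multiset.sum_bind]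
  rfl

/-! ### The symbol -/

open scoped ComplexOrder in
theorem sqrt_unitary_conj_diagonal {m : ℕ} {V : Matrix (Fin m) (Fin m) ℂ} (hV : Vᴴ * V = 1)
    {x : Fin m → ℝ} (hx : ∀ j, 0 ≤ x j) :
    CFC.sqrt (V * Matrix.diagonal (fun j => ((x j ^ 2 : ℝ) : ℂ)) * Vᴴ)
      = V * Matrix.diagonal (fun j => (x j : ℂ)) * Vᴴ := by
  refine CFC.sqrt_unique ?_ ?_
  · have hD : Matrix.diagonal (fun j => (x j : ℂ)) * Matrix.diagonal (fun j => (x j : ℂ))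
        = Matrix.diagonal (fun j => ((x j ^ 2 : ℝ) : ℂ)) := by
      rw [Matrix.diagonal_mul_diagonal]
      congr 1
      ext j
      push_cast
      ring
    rw [← hD]
    calc _ = V * Matrix.diagonal (fun j => (x j : ℂ)) * (Vᴴ * V)
          * Matrix.diagonal (fun j => (x j : ℂ)) * Vᴴ := by simp only [mul_assoc]
      _ = _ := by rw [hV, mul_one]; simp only [mul_assoc]
  · rw [Matrix.nonneg_iff_posSemidef]
    refine Matrix.PosSemidef.mul_mul_conjTranspose_same (Matrix.PosSemidef.diagonal fun j => ?_) V
    simpa using hx j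

open scoped ComplexOrder in
theorem matrixAbs_sq {m : ℕ} (M : Matrix (Fin m) (Fin m) ℂ) : matrixAbs M ^ 2 = Mᴴ * M :=
  CFC.sq_sqrt _ (Matrix.nonneg_iff_posSemidef.mpr (Matrix.posSemidef_conjTranspose_mul_self M))

theorem map_ofReal_mul {m : ℕ} (X Y : Matrix (Fin m) (Fin m) ℝ) :
    (X * Y).map Complex.ofReal = X.map Complex.ofReal * Y.map Complex.ofReal :=
  Matrix.map_mul (f := Complex.ofRealHom)

theorem conjTranspose_map_ofReal {m : ℕ} (X : Matrix (Fin m) (Fin m) ℝ) :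
    (X.map Complex.ofReal)ᴴ = Xᵀ.map Complex.ofReal := by
  ext i j
  simp

theorem map_ofReal_one {m : ℕ} : (1 : Matrix (Fin m) (Fin m) ℝ).map Complex.ofReal = 1 :=
  Matrix.map_one _ Complex.ofReal_zero Complex.ofReal_one

theorem conjTranspose_mul_self_map_ofReal {m : ℕ} {U : Matrix (Fin m) (Fin m) ℝ}
    (hU : Uᵀ * U = 1) : (U.map Complex.ofReal)ᴴ * U.map Complex.ofReal = 1 := by
  rw [conjTranspose_map_ofReal, ← map_ofReal_mul, hU, map_ofReal_one]

theorem mul_conjTranspose_self_map_ofReal {m : ℕ} {U : Matrix (Fin m) (Fin m) ℝ}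
    (hU : U * Uᵀ = 1) : U.map Complex.ofReal * (U.map Complex.ofReal)ᴴ = 1 := by
  rw [conjTranspose_map_ofReal, ← map_ofReal_mul, hU, map_ofReal_one]

theorem waveL_map_eq {m : ℕ} (τ : ℝ) {U Δ : Matrix (Fin m) (Fin m) ℝ} {d : Fin m → ℝ}
    (hU : U * Uᵀ = 1) (hΔ : Δ = U * Matrix.diagonal d * Uᵀ) :
    (waveL τ Δ).map Complex.ofReal = U.map Complex.ofReal
      * Matrix.diagonal (fun j => ((1 + -(τ ^ 2 / 2) * d j : ℝ) : ℂ))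
      * (U.map Complex.ofReal)ᴴ := by
  have h : waveL τ Δ = U * Matrix.diagonal (fun j => 1 + -(τ ^ 2 / 2) * d j) * Uᵀ := by
    have hD : Matrix.diagonal (fun j => 1 + -(τ ^ 2 / 2) * d j)
        = 1 - (τ ^ 2 / 2) • Matrix.diagonal d := by
      ext i j
      by_cases hij : i = j <;> simp [hij, sub_eq_add_neg]
    rw [waveL, hΔ, hD, mul_sub, sub_mul, mul_one, hU, mul_smul_comm, smul_mul_assoc]
  rw [h, map_ofReal_mul, map_ofReal_mul, ← conjTranspose_map_ofReal,
    Matrix.diagonal_map Complex.ofReal_zero]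

/-- The eigenvalue of `h(θ)` for the parameter `c`, with the phase `e^{iθ}` split off. -/
theorem scalar_waveH (c θ : ℝ) :
    Complex.exp (Complex.I * θ) * ((2 * (1 + c) * Real.cos θ - 2 : ℝ) : ℂ)
      = ((1 + c : ℝ) : ℂ) - 2 * Complex.exp (Complex.I * θ)
        + Complex.exp (2 * Complex.I * θ) * ((1 + c : ℝ) : ℂ) := by
  have h₁ : Complex.exp (Complex.I * θ) * Complex.exp (-(θ : ℂ) * Complex.I) = 1 := by
    rw [← Complex.exp_add]; simp [mul_comm]
  have h₂ : Complex.exp (2 * Complex.I * θ)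
      = Complex.exp (Complex.I * θ) * Complex.exp (Complex.I * θ) := by
    rw [← Complex.exp_add]; ring_nf
  have h₃ := Complex.two_cos (θ : ℂ)
  rw [mul_comm (θ : ℂ) Complex.I] at h₃
  rw [h₂]
  push_cast
  linear_combination (Complex.exp (Complex.I * θ) * (1 + c)) * h₃ + (1 + (c : ℂ)) * h₁

theorem waveH_eq {m : ℕ} (τ : ℝ) {U Δ : Matrix (Fin m) (Fin m) ℝ} {d : Fin m → ℝ}
    (hU : U * Uᵀ = 1) (hΔ : Δ = U * Matrix.diagonal d * Uᵀ) (θ : ℝ) :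
    waveH τ Δ θ = U.map Complex.ofReal
      * Matrix.diagonal (fun j => Complex.exp (Complex.I * θ)
        * ((2 * (1 + -(τ ^ 2 / 2) * d j) * Real.cos θ - 2 : ℝ) : ℂ))
      * (U.map Complex.ofReal)ᴴ := by
  have hD : Matrix.diagonal (fun j => Complex.exp (Complex.I * θ)
        * ((2 * (1 + -(τ ^ 2 / 2) * d j) * Real.cos θ - 2 : ℝ) : ℂ))
      = Matrix.diagonal (fun j => ((1 + -(τ ^ 2 / 2) * d j : ℝ) : ℂ))
        - (2 * Complex.exp (Complex.I * (θ : ℂ))) • (1 : Matrix (Fin m) (Fin m) ℂ)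
        + Complex.exp (2 * Complex.I * (θ : ℂ))
          • Matrix.diagonal (fun j => ((1 + -(τ ^ 2 / 2) * d j : ℝ) : ℂ)) := by
    simp only [scalar_waveH]
    ext i j
    by_cases hij : i = j
    · subst hij
      simp only [Matrix.diagonal_apply_eq, Matrix.add_apply, Matrix.sub_apply,
        Matrix.smul_apply, Matrix.one_apply_eq, smul_eq_mul, mul_one]
    · simp [hij]
  rw [waveH, waveL_map_eq τ hU hΔ, hD, mul_add, mul_sub, add_mul, sub_mul, mul_smul_comm,
    mul_smul_comm, smul_mul_assoc, smul_mul_assoc, mul_one, mul_conjTranspose_self_map_ofReal hU]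

theorem conjTranspose_mul_self_conj_diagonal {m : ℕ} {V : Matrix (Fin m) (Fin m) ℂ}
    (hV : Vᴴ * V = 1) (x : Fin m → ℂ) :
    (V * Matrix.diagonal x * Vᴴ)ᴴ * (V * Matrix.diagonal x * Vᴴ)
      = V * Matrix.diagonal (fun j => star (x j) * x j) * Vᴴ := by
  rw [Matrix.conjTranspose_mul, Matrix.conjTranspose_mul, Matrix.conjTranspose_conjTranspose,
    Matrix.diagonal_conjTranspose]
  calc V * (Matrix.diagonal (star x) * Vᴴ) * (V * Matrix.diagonal x * Vᴴ)
      = V * Matrix.diagonal (star x) * (Vᴴ * V) * Matrix.diagonal x * Vᴴ := by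
        simp only [mul_assoc]
    _ = V * (Matrix.diagonal (star x) * Matrix.diagonal x) * Vᴴ := by
        rw [hV, mul_one]; simp only [mul_assoc]
    _ = _ := by rw [Matrix.diagonal_mul_diagonal]; rfl

/-- `|h|² + a² = g²` for the eigenvalues. -/
theorem star_mul_self_phase_add (a c θ : ℝ) :
    star (Complex.exp (Complex.I * θ) * ((2 * (1 + c) * Real.cos θ - 2 : ℝ) : ℂ))
        * (Complex.exp (Complex.I * θ) * ((2 * (1 + c) * Real.cos θ - 2 : ℝ) : ℂ)) + (a : ℂ) ^ 2
      = ((scalarG a c θ ^ 2 : ℝ) : ℂ) := by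
  have h₁ : (starRingEnd ℂ) (Complex.exp (Complex.I * θ)) * Complex.exp (Complex.I * θ) = 1 := by
    rw [← Complex.exp_conj, ← Complex.exp_add]; simp
  rw [scalarG_sq, ← starRingEnd_apply, map_mul, Complex.conj_ofReal]
  push_cast
  linear_combination ((2 * (1 + c) * Complex.cos θ - 2) ^ 2 : ℂ) * h₁

/-- The symbol is diagonalised by any orthonormal eigenbasis of `Δ`. -/
theorem waveG_eq {m : ℕ} (τ γ : ℝ) {U Δ : Matrix (Fin m) (Fin m) ℝ} {d : Fin m → ℝ}
    (hU : Uᵀ * U = 1) (hU' : U * Uᵀ = 1) (hΔ : Δ = U * Matrix.diagonal d * Uᵀ) (θ : ℝ) :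
    waveG τ γ Δ θ = U.map Complex.ofReal
      * Matrix.diagonal (fun j => (scalarG (alpha τ γ) (-(τ ^ 2 / 2) * d j) θ : ℂ))
      * (U.map Complex.ofReal)ᴴ := by
  rw [waveG, matrixAbs_sq, waveH_eq τ hU' hΔ, conjTranspose_mul_self_conj_diagonal
    (conjTranspose_mul_self_map_ofReal hU),
    ← sqrt_unitary_conj_diagonal (conjTranspose_mul_self_map_ofReal hU)
      (fun j => scalarG_nonneg _ _ _)]
  congr 1
  simp only [← star_mul_self_phase_add]
  rw [← Matrix.diagonal_add, mul_add, add_mul, ← Matrix.smul_one_eq_diagonal, mul_smul_comm,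
    smul_mul_assoc, mul_one, mul_conjTranspose_self_map_ofReal hU']

theorem sum_map_roots_conj_diagonal {m : ℕ} {V : Matrix (Fin m) (Fin m) ℂ} (hV : Vᴴ * V = 1)
    (x : Fin m → ℂ) (F : ℂ → ℂ) :
    ((V * Matrix.diagonal x * Vᴴ).charpoly.roots.map F).sum = ∑ j, F (x j) := by
  rw [charpoly_mul_mul_of_mul_eq_one hV, Matrix.charpoly_diagonal,
    Polynomial.roots_prod _ _ (Finset.prod_ne_zero_iff.mpr fun i _ =>
      Polynomial.X_sub_C_ne_zero _)]
  simp only [Polynomial.roots_X_sub_C, Multiset.bind_singleton, Multiset.map_map]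
  rfl

theorem sum_map_roots_waveG {m : ℕ} (τ γ : ℝ) {U Δ : Matrix (Fin m) (Fin m) ℝ} {d : Fin m → ℝ}
    (hU : Uᵀ * U = 1) (hU' : U * Uᵀ = 1) (hΔ : Δ = U * Matrix.diagonal d * Uᵀ) (θ : ℝ)
    (F : ℂ → ℂ) :
    ((waveG τ γ Δ θ).charpoly.roots.map F).sum
        = ∑ j, F (scalarG (alpha τ γ) (-(τ ^ 2 / 2) * d j) θ) ∧
      ((-waveG τ γ Δ θ).charpoly.roots.map F).sum
        = ∑ j, F (-scalarG (alpha τ γ) (-(τ ^ 2 / 2) * d j) θ) := by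
  have hV := conjTranspose_mul_self_map_ofReal hU
  rw [waveG_eq τ γ hU hU' hΔ, ← neg_mul, ← mul_neg, Matrix.diagonal_neg]
  exact ⟨sum_map_roots_conj_diagonal hV _ F, sum_map_roots_conj_diagonal hV _ F⟩

theorem doubledDomain_eq : doubledDomain (Set.Icc 0 (2 * Real.pi)) (-2 * Real.pi)
    = Set.Icc (-(2 * Real.pi)) (2 * Real.pi) := by
  have hpi := Real.pi_pos
  rw [doubledDomain, Set.image_const_add_Icc, Set.union_comm]
  convert Set.Icc_union_Icc_eq_Icc (a := -(2 * Real.pi)) (b := 0) (c := 2 * Real.pi)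
    (by linarith) (by linarith) using 3 <;> ring

open Classical in
theorem measurable_psi_apply {m : ℕ} (D : Set ℝ) (hD : MeasurableSet D) (p : ℝ)
    {g : ℝ → Matrix (Fin m) (Fin m) ℂ} (hg : ∀ i j, Measurable fun θ => g θ i j) (i j : Fin m) :
    Measurable fun θ => psi D p g θ i j := by
  have h : (fun θ => psi D p g θ i j) = D.piecewise (fun θ => g θ i j)
      (fun θ => -g (θ - p) i j) := by
    ext θ
    by_cases hθ : θ ∈ D <;> simp [psi, hθ]
  rw [h]
  exact (hg i j).piecewise hD ((hg i j).comp (measurable_id.sub_const p)).neg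

/-- On `[0, 2π]` the function `psi` has the eigenvalues `scalarG`, on `[-2π, 0)` their negatives, moved
by one period. -/
theorem symbolFunctional_psi_waveG {m : ℕ} (τ γ : ℝ) {U Δ : Matrix (Fin m) (Fin m) ℝ}
    {d : Fin m → ℝ} (hU : Uᵀ * U = 1) (hU' : U * Uᵀ = 1) (hΔ : Δ = U * Matrix.diagonal d * Uᵀ)
    (F : C_c(ℂ, ℂ)) :
    symbolFunctional (doubledDomain (Set.Icc 0 (2 * Real.pi)) (-2 * Real.pi))
        (psi (Set.Icc 0 (2 * Real.pi)) (-2 * Real.pi) (waveG τ γ Δ)) F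
      = ∑ j, (1 / (m : ℂ)) * ((1 / (4 * Real.pi)) * ∫ θ in (0 : ℝ)..(2 * Real.pi),
          (F (scalarG (alpha τ γ) (-(τ ^ 2 / 2) * d j) θ : ℂ)
            + F (-scalarG (alpha τ γ) (-(τ ^ 2 / 2) * d j) θ : ℂ))) := by
  have hpi := Real.pi_pos
  have hF : Continuous F := F.continuous
  set G : Fin m → ℝ → ℝ := fun j => scalarG (alpha τ γ) (-(τ ^ 2 / 2) * d j) with hG
  have hGc : ∀ j, Continuous (G j) := fun j => continuous_scalarG _ _
  set S : ℝ → ℂ := fun θ => ((psi (Set.Icc 0 (2 * Real.pi)) (-2 * Real.pi)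
    (waveG τ γ Δ) θ).charpoly.roots.map F).sum with hS
  have hpos : Set.EqOn (fun θ => ∑ j, F (G j θ : ℂ)) S (Set.Icc 0 (2 * Real.pi)) := by
    intro θ hθ
    simp only [hS, psi, if_pos hθ]
    exact ((sum_map_roots_waveG τ γ hU hU' hΔ θ F).1).symm
  have hneg : Set.EqOn (fun θ => ∑ j, F (-G j (θ + 2 * Real.pi) : ℂ)) S
      (Set.Ico (-(2 * Real.pi)) 0) := by
    intro θ hθ
    have hθ' : θ ∉ Set.Icc 0 (2 * Real.pi) := fun h => absurd h.1 (not_le.mpr hθ.2)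
    simp only [hS, psi, if_neg hθ']
    rw [show θ - -2 * Real.pi = θ + 2 * Real.pi by ring]
    exact ((sum_map_roots_waveG τ γ hU hU' hΔ _ F).2).symm
  have hcpos : Continuous fun θ => ∑ j, F (G j θ : ℂ) := by fun_prop
  have hcneg : Continuous fun θ => ∑ j, F (-G j (θ + 2 * Real.pi) : ℂ) := by fun_prop
  have hsplit : ∫ θ in Set.Icc (-(2 * Real.pi)) (2 * Real.pi), S θ
      = (∫ θ in (0 : ℝ)..(2 * Real.pi), ∑ j, F (-G j θ : ℂ))
        + ∫ θ in (0 : ℝ)..(2 * Real.pi), ∑ j, F (G j θ : ℂ) := by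
    have hunion : Set.Icc (-(2 * Real.pi)) (2 * Real.pi)
        = Set.Ico (-(2 * Real.pi)) 0 ∪ Set.Icc 0 (2 * Real.pi) :=
      (Set.Ico_union_Icc_eq_Icc (by linarith) (by linarith)).symm
    have hdisj : Disjoint (Set.Ico (-(2 * Real.pi)) 0) (Set.Icc 0 (2 * Real.pi)) :=
      Set.disjoint_left.mpr fun θ h h' => absurd h'.1 (not_le.mpr h.2)
    rw [hunion, setIntegral_union hdisj measurableSet_Icc
      ((hcneg.integrableOn_Icc.mono_set Set.Ico_subset_Icc_self).congr_fun hneg measurableSet_Ico)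
      (hcpos.integrableOn_Icc.congr_fun hpos measurableSet_Icc),
      ← setIntegral_congr_fun measurableSet_Ico hneg,
      ← setIntegral_congr_fun measurableSet_Icc hpos, integral_Ico_eq_integral_Ioc,
      integral_Icc_eq_integral_Ioc, ← intervalIntegral.integral_of_le (by linarith),
      ← intervalIntegral.integral_of_le (by linarith),
      intervalIntegral.integral_comp_add_right (fun θ => ∑ j, F (-G j θ : ℂ)),
      neg_add_cancel, zero_add]
  have hsum : ∀ f : Fin m → ℝ → ℂ, (∀ j, Continuous (f j)) →
      ∫ θ in (0 : ℝ)..(2 * Real.pi), ∑ j, f j θ = ∑ j, ∫ θ in (0 : ℝ)..(2 * Real.pi), f j θ :=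
    fun f hf => intervalIntegral.integral_finsetSum fun j _ => (hf j).intervalIntegrable _ _
  rw [symbolFunctional, doubledDomain_eq, hsplit, hsum _ (fun j => by fun_prop),
    hsum _ (fun j => by fun_prop), ← Finset.sum_add_distrib, Finset.mul_sum,
    Real.volume_real_Icc_of_le (by linarith)]
  refine Finset.sum_congr rfl fun j _ => ?_
  rw [intervalIntegral.integral_add ((by fun_prop : Continuous _).intervalIntegrable _ _)
    ((by fun_prop : Continuous _).intervalIntegrable _ _), ← mul_assoc, add_comm]
  congr 1
  push_cast
  rw [div_mul_div_comm, one_mul]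
  congr 2
  ring

theorem measurable_waveG_apply {m : ℕ} (τ γ : ℝ) {U Δ : Matrix (Fin m) (Fin m) ℝ} {d : Fin m → ℝ}
    (hU : Uᵀ * U = 1) (hU' : U * Uᵀ = 1) (hΔ : Δ = U * Matrix.diagonal d * Uᵀ) (i j : Fin m) :
    Measurable fun θ => waveG τ γ Δ θ i j := by
  simp only [waveG_eq τ γ hU hU' hΔ, Matrix.mul_apply]
  exact (by fun_prop : Continuous _).measurable

/-! ### Fourier coefficients and the eigenvalue distribution -/

theorem matrixFourierCoeff_waveH {m : ℕ} (τ : ℝ) (Δ : Matrix (Fin m) (Fin m) ℝ) (k : ℤ)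
    (i j : Fin m) : matrixFourierCoeff (waveH τ Δ) k i j
      = (if k = 0 then (waveL τ Δ i j : ℂ) else 0)
        - (if k = 1 then 2 * (1 : Matrix (Fin m) (Fin m) ℂ) i j else 0)
        + (if k = 2 then (waveL τ Δ i j : ℂ) else 0) := by
  have hpi : (Real.pi : ℂ) ≠ 0 := Complex.ofReal_ne_zero.mpr Real.pi_ne_zero
  set l : ℂ := (waveL τ Δ i j : ℂ)
  set δ : ℂ := (1 : Matrix (Fin m) (Fin m) ℂ) i j
  have hint : ∀ r : ℤ, ∫ θ in (-Real.pi)..Real.pi, Complex.exp (Complex.I * (r - k : ℤ) * (θ : ℂ))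
      = if k = r then 2 * (Real.pi : ℂ) else 0 := fun r => by
    have h := integral_cexp_int (r - k) (-Real.pi)
    rw [show -Real.pi + 2 * Real.pi = Real.pi by ring] at h
    rw [h]
    exact if_congr (by rw [sub_eq_zero, eq_comm]) rfl rfl
  have hexp : ∀ θ : ℝ, waveH τ Δ θ i j * Complex.exp (-Complex.I * (k : ℂ) * (θ : ℂ))
      = l * Complex.exp (Complex.I * (0 - k : ℤ) * (θ : ℂ))
        - 2 * δ * Complex.exp (Complex.I * (1 - k : ℤ) * (θ : ℂ))
        + l * Complex.exp (Complex.I * (2 - k : ℤ) * (θ : ℂ)) := by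
    intro θ
    have e₀ : Complex.exp (Complex.I * (0 - k : ℤ) * (θ : ℂ))
        = Complex.exp (-Complex.I * (k : ℂ) * (θ : ℂ)) := by
      push_cast; ring_nf
    have e₁ : Complex.exp (Complex.I * (1 - k : ℤ) * (θ : ℂ))
        = Complex.exp (Complex.I * θ) * Complex.exp (-Complex.I * (k : ℂ) * (θ : ℂ)) := by
      rw [← Complex.exp_add]; push_cast; ring_nf
    have e₂ : Complex.exp (Complex.I * (2 - k : ℤ) * (θ : ℂ))
        = Complex.exp (2 * Complex.I * θ) * Complex.exp (-Complex.I * (k : ℂ) * (θ : ℂ)) := by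
      rw [← Complex.exp_add]; push_cast; ring_nf
    rw [e₀, e₁, e₂]
    simp only [waveH, Matrix.add_apply, Matrix.sub_apply, Matrix.smul_apply, Matrix.map_apply,
      smul_eq_mul]
    ring
  have hii : ∀ f : ℝ → ℂ, Continuous f →
      IntervalIntegrable f volume (-Real.pi) Real.pi := fun f hf => hf.intervalIntegrable _ _
  rw [matrixFourierCoeff, Matrix.of_apply]
  simp only [hexp]
  rw [intervalIntegral.integral_add (hii _ (by fun_prop)) (hii _ (by fun_prop)),
    intervalIntegral.integral_sub (hii _ (by fun_prop)) (hii _ (by fun_prop)),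
    intervalIntegral.integral_const_mul, intervalIntegral.integral_const_mul,
    intervalIntegral.integral_const_mul, hint, hint, hint]
  split_ifs <;> field_simp <;> ring

theorem waveT_eq_blockToeplitz {m : ℕ} (τ : ℝ) (Δ : Matrix (Fin m) (Fin m) ℝ) (n : ℕ) :
    (waveT τ Δ n).map Complex.ofReal = blockToeplitz n (waveH τ Δ) := by
  ext1 ⟨r, i⟩ ⟨s, j⟩
  rw [blockToeplitz, Matrix.of_apply, matrixFourierCoeff_waveH]
  have h₀ : ((r.val : ℤ) - s.val = 0) ↔ r.val = s.val := by omega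
  have h₁ : ((r.val : ℤ) - s.val = 1) ↔ r.val = s.val + 1 := by omega
  have h₂ : ((r.val : ℤ) - s.val = 2) ↔ r.val = s.val + 2 := by omega
  simp only [h₀, h₁, h₂, Matrix.map_apply, waveT, Matrix.sub_apply, Matrix.smul_apply,
    Matrix.kroneckerMap_apply, B₁, B₂, Matrix.of_apply, waveL, Matrix.one_apply, smul_eq_mul]
  split_ifs <;> first | omega | (push_cast; ring)

theorem hasEigenvalueDistribution_waveA {m : ℕ} (τ γ : ℝ)
    {U Δ : Matrix (Fin m) (Fin m) ℝ} {d : Fin m → ℝ} (hU : Uᵀ * U = 1) (hU' : U * Uᵀ = 1)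
    (hΔ : Δ = U * Matrix.diagonal d * Uᵀ) :
    HasEigenvalueDistribution (fun n => (waveA τ γ Δ n).map Complex.ofReal)
      (symbolFunctional (doubledDomain (Set.Icc 0 (2 * Real.pi)) (-2 * Real.pi))
        (psi (Set.Icc 0 (2 * Real.pi)) (-2 * Real.pi) (waveG τ γ Δ))) := by
  intro F
  rw [symbolFunctional_psi_waveG τ γ hU hU' hΔ F]
  refine (tendsto_finsetSum Finset.univ fun j _ =>
    (tendsto_mean_roots_scalarA (alpha τ γ) (-(τ ^ 2 / 2) * d j)
      (F : C(ℂ, ℂ))).const_mul (1 / (m : ℂ))).congr fun n => ?_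
  rw [sum_map_roots_waveA τ γ hU hU' hΔ, ← Finset.mul_sum, ← Finset.mul_sum, ← mul_assoc]
  congr 1
  rw [Fintype.card_sum, Fintype.card_prod, Fintype.card_fin, Fintype.card_fin]
  push_cast
  rw [div_mul_div_comm, one_mul]
  congr 1
  ring

end WaveControl

/-- The number of space grid points `m`, the step `τ`, the regularization parameter `γ` and the
discrete Laplacian `Δ` (with `-Δ` symmetric positive definite) are fixed, and `n → ∞`. -/
theorem corollary3p2 (m : ℕ) (hm : 0 < m) (τ γ : ℝ) (hτ : 0 < τ) (hγ : 0 < γ)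
    (Δ : Matrix (Fin m) (Fin m) ℝ) (hΔ : (-Δ).PosDef) :
    (∀ n : ℕ, (WaveControl.waveT τ Δ n).map Complex.ofReal
        = WaveControl.blockToeplitz n (WaveControl.waveH τ Δ)) ∧
    WaveControl.HasEigenvalueSymbol
      (fun n => (WaveControl.waveA τ γ Δ n).map Complex.ofReal)
      (WaveControl.doubledDomain (Set.Icc 0 (2 * Real.pi)) (-2 * Real.pi))
      (WaveControl.psi (Set.Icc 0 (2 * Real.pi)) (-2 * Real.pi) (WaveControl.waveG τ γ Δ)) := by
  have hherm : Δ.IsHermitian := by simpa using hΔ.isHermitian.neg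
  obtain ⟨U, d, hU, hU', hdiag⟩ := WaveControl.exists_orthogonal_diagonalization hherm
  refine ⟨WaveControl.waveT_eq_blockToeplitz τ Δ, ?_, ?_, ?_, fun i j => ?_,
    WaveControl.hasEigenvalueDistribution_waveA τ γ hU hU' hdiag⟩
  · rw [WaveControl.doubledDomain_eq]
    exact measurableSet_Icc
  · rw [WaveControl.doubledDomain_eq, Real.volume_Icc, ENNReal.ofReal_pos]
    linarith [Real.pi_pos]
  · rw [WaveControl.doubledDomain_eq, Real.volume_Icc]
    exact ENNReal.ofReal_lt_top
  · exact (WaveControl.measurable_psi_apply _ measurableSet_Icc _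
      (WaveControl.measurable_waveG_apply τ γ hU hU' hdiag) i j).comp measurable_subtype_coe
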